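/- Let $F$ be a field of characteristic different from $2$ which is either finite (with the discrete topology) or non-archimedean local, let $R$ be a field, and let $\psi : F \to R^\times$ be a non-trivial smooth character (i.e. its kernel is open). For a finite-dimensional symplectic space $(W,\langle\,,\,\rangle)$ over $F$, the Heisenberg group $H(W)$ is $W\times F$ with the product topology and the law $(w,t)(w',t')=(w+w',\,t+t'+\tfrac12\langle w,w'\rangle)$; its centre is identified with $F$ by $t\mapsto(0,t)$. An $R$-linear representation $V$ of $H(W)$ is smooth if all stabilisers of vectors are open, and its contragredient $V^\vee$ is the space of smooth vectors of $\mathrm{Hom}_R(V,R)$. The Heisenberg representation $\rho_\psi$ of $H(W)$ is the irreducible smooth $R$-representation of $H(W)$ on which the centre $F$ acts by $\psi$ (unique up to isomorphism; any representation with these properties is called the Heisenberg representation associated to $\psi$). Then: a) $\rho_\psi^\vee \cong \rho_{\psi^{-1}}$; that is, $\rho_\psi^\vee$ is the Heisenberg representation associated to $\psi^{-1}$. b) $\rho_\psi$ is admissible (for every compact open subgroup $K$ of $H(W)$ the space of $K$-fixed vectors is finite-dimensional over $R$), absolutely irreducible ($\rho_\psi\otimes_R R'$ is irreducible for every field extension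 $R'/R$), and satisfies Schur's lemma, i.e. $\mathrm{End}_{R[H(W)]}(\rho_\psi)=R$. c) Every smooth $R$-representation of $H(W)$ with central character $\psi$ is semisimple. d) Let $W=W_1\oplus W_2$ be the orthogonal sum of two finite-dimensional symplectic spaces over $F$, and let $\rho^1_\psi,\rho^2_\psi$ be the Heisenberg representations of $H(W_1)$, $H(W_2)$ associated to $\psi$. Then $$(w_1+w_2,t)\longmapsto \psi(t)\cdot\bigl(\rho^1_\psi((w_1,0))\otimes\rho^2_\psi((w_2,0))\bigr)$$ is a representation of $H(W)$ on $\rho^1_\psi\otimes_R\rho^2_\psi$, and it is the Heisenberg representation of $H(W)$ associated to $\psi$. -/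

import Mathlib

open scoped TensorProduct

universe uF uR uE uW uW₁ uW₂ uS uS' uS₁ uS₂ uV

/-! ### Base field and characters -/

/-- A topological field `F` which is either finite (with the discrete topology) or a
non-archimedean local field. -/
def IsFiniteOrNonarchimedeanLocal (F : Type*) [Field F] [TopologicalSpace F] : Prop :=
  (Finite F ∧ DiscreteTopology F) ∨ ∃ _ : ValuativeRel F, IsNonarchimedeanLocalField F

/-- An additive character of a topological group is smooth if its kernel is open. -/
def IsSmoothAddChar {F R : Type*} [AddCommGroup F] [TopologicalSpace F] [CommRing R]
    (ψ : AddChar F R) : Prop :=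
  IsOpen {t : F | ψ t = 1}

/-! ### Smooth representations of a topological group -/

section Smooth

variable {R G V : Type*} [Field R] [Group G] [TopologicalSpace G] [AddCommGroup V] [Module R V]

/-- A representation is smooth if the stabiliser of every vector is open. -/
def IsSmoothRep (ρ : Representation R G V) : Prop :=
  ∀ v : V, IsOpen {g : G | ρ g v = v}

/-- A representation is admissible if it is smooth and the space of vectors fixed by any compact
open subgroup is finite dimensional. -/
def IsAdmissibleRep (ρ : Representation R G V) : Prop :=
  IsSmoothRep ρ ∧ ∀ K : Subgroup G, IsOpen (K : Set G) → IsCompact (K : Set G) →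
    FiniteDimensional R (Representation.invariants (ρ.comp K.subtype))

/-- The stabiliser of a vector, as a subgroup. -/
def repStabilizer (ρ : Representation R G V) (v : V) : Subgroup G where
  carrier := {g | ρ g v = v}
  mul_mem' := by
    intro a b ha hb
    simp only [Set.mem_ofPred_eq] at ha hb ⊢
    rw [map_mul, Module.End.mul_apply, hb, ha]
  one_mem' := by simp
  inv_mem' := by
    intro a ha
    simp only [Set.mem_ofPred_eq] at ha ⊢
    rw [Representation.inv_apply_eq_iff, ha]

/-- The subrepresentation of smooth vectors, that is, of vectors with open stabiliser. -/
def smoothVectors [IsTopologicalGroup G] (ρ : Representation R G V) : Subrepresentation ρ where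
  toSubmodule :=
    { carrier := {v | IsOpen {g : G | ρ g v = v}}
      add_mem' := by
        intro v w hv hw
        refine Subgroup.isOpen_mono (H₁ := repStabilizer ρ v ⊓ repStabilizer ρ w)
          (H₂ := repStabilizer ρ (v + w)) ?_ (hv.inter hw)
        rintro g ⟨h₁, h₂⟩
        change ρ g (v + w) = v + w
        rw [map_add, show ρ g v = v from h₁, show ρ g w = w from h₂]
      zero_mem' := by simp
      smul_mem' := by
        intro c v hv
        refine Subgroup.isOpen_mono (H₁ := repStabilizer ρ v) (H₂ := repStabilizer ρ (c • v)) ?_ hv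
        intro g h
        change ρ g (c • v) = c • v
        rw [map_smul, show ρ g v = v from h] }
  apply_mem_toSubmodule := by
    intro g v hv
    have hc : Continuous fun x : G => g⁻¹ * x * g := by fun_prop
    have e : (fun x : G => g⁻¹ * x * g) ⁻¹' {x : G | ρ x v = v} =
        {x : G | ρ x (ρ g v) = ρ g v} := by
      ext x
      simp only [Set.mem_ofPred_eq, Set.mem_preimage, map_mul, Module.End.mul_apply]
      rw [Representation.inv_apply_eq_iff]
    have h : IsOpen ((fun x : G => g⁻¹ * x * g) ⁻¹' {x : G | ρ x v = v}) := hv.preimage hc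
    rw [e] at h
    exact h

/-- The contragredient: the smooth vectors of the full linear dual. -/
abbrev contragredient [IsTopologicalGroup G] (ρ : Representation R G V) :
    Representation R G (smoothVectors ρ.dual).toSubmodule :=
  (smoothVectors ρ.dual).toRepresentation

/-- Extension of scalars of a representation along `R → R'`. -/
noncomputable def repBaseChange (R' : Type*) [Field R'] [Algebra R R']
    (ρ : Representation R G V) : Representation R' G (R' ⊗[R] V) where
  toFun g := (ρ g).baseChange R'
  map_one' := by ext; simp
  map_mul' a b := by ext; simp

/-- A representation is absolutely irreducible if it stays irreducible over every extension of
the coefficient field. -/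
def IsAbsolutelyIrreducible.{w, u, uG, v} {R : Type u} {G : Type uG} {V : Type v} [Field R]
    [Group G] [AddCommGroup V] [Module R V] (ρ : Representation R G V) : Prop :=
  ∀ (R' : Type w) [Field R'] [Algebra R R'], (repBaseChange R' ρ).IsIrreducible

/-- Schur's lemma holds for `ρ`: the scalars are exactly the endomorphisms of `ρ`. -/
def SatisfiesSchur (ρ : Representation R G V) : Prop :=
  Function.Bijective (algebraMap R (Representation.IntertwiningMap ρ ρ))

end Smooth

/-! ### The Heisenberg group -/

/-- The underlying set `W × F` of the Heisenberg group of a bilinear form on `W`. -/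
@[ext]
structure Heisenberg {F W : Type*} [Field F] [AddCommGroup W] [Module F W]
    (B : LinearMap.BilinForm F W) where
  /-- the component in `W` -/
  vec : W
  /-- the component in `F` -/
  cen : F

namespace Heisenberg

variable {F W : Type*} [Field F] [AddCommGroup W] [Module F W] (B : LinearMap.BilinForm F W)

/-- `(w, t) * (w', t') = (w + w', t + t' + B w w' / 2)`. For alternating `B` the inverse of
`(w, t)` is `(-w, -t)`. -/
instance : Mul (Heisenberg B) := ⟨fun x y => ⟨x.vec + y.vec, x.cen + y.cen + B x.vec y.vec / 2⟩⟩

instance : One (Heisenberg B) := ⟨⟨0, 0⟩⟩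

instance : Inv (Heisenberg B) := ⟨fun x => ⟨-x.vec, -x.cen + B x.vec x.vec / 2⟩⟩

@[simp] theorem vec_mul (x y : Heisenberg B) : (x * y).vec = x.vec + y.vec := rfl

@[simp] theorem cen_mul (x y : Heisenberg B) :
    (x * y).cen = x.cen + y.cen + B x.vec y.vec / 2 := rfl

@[simp] theorem vec_one : (1 : Heisenberg B).vec = 0 := rfl

@[simp] theorem cen_one : (1 : Heisenberg B).cen = 0 := rfl

@[simp] theorem vec_inv (x : Heisenberg B) : (x⁻¹).vec = -x.vec := rfl

@[simp] theorem cen_inv (x : Heisenberg B) : (x⁻¹).cen = -x.cen + B x.vec x.vec / 2 := rfl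

instance : Group (Heisenberg B) :=
  Group.ofLeftAxioms
    (by
      intro x y z
      ext
      · simp [add_assoc]
      · simp only [cen_mul, vec_mul, map_add, LinearMap.add_apply]
        ring)
    (by intro x; ext <;> simp)
    (by
      intro x
      ext
      · simp
      · simp only [cen_mul, cen_inv, vec_inv, map_neg, LinearMap.neg_apply, cen_one]
        ring)

variable [TopologicalSpace F]

/-- The product topology on `W × F`, where `W` carries its canonical topology as a vector space
over `F` (for `W` of finite dimension: the product topology in any basis). -/
instance : TopologicalSpace (Heisenberg B) :=
  letI : TopologicalSpace W := moduleTopology F W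
  TopologicalSpace.induced (fun x : Heisenberg B => (x.vec, x.cen)) inferInstance

instance [IsTopologicalRing F] [FiniteDimensional F W] : IsTopologicalGroup (Heisenberg B) := by
  let _ : TopologicalSpace W := moduleTopology F W
  have : IsModuleTopology F W := ⟨rfl⟩
  have : ContinuousAdd W := IsModuleTopology.toContinuousAdd F W
  have : ContinuousNeg W := IsModuleTopology.continuousNeg F W
  have hi : Continuous fun x : Heisenberg B => (x.vec, x.cen) := continuous_induced_dom
  have hv : Continuous fun x : Heisenberg B => x.vec := continuous_fst.comp hi
  have ht : Continuous fun x : Heisenberg B => x.cen := continuous_snd.comp hi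
  have hB : Continuous fun p : W × W => B p.1 p.2 :=
    IsModuleTopology.continuous_bilinear_of_finite_left B
  refine { continuous_mul := ?_, continuous_inv := ?_ }
  · refine continuous_induced_rng.mpr ?_
    refine Continuous.prodMk ((hv.comp continuous_fst).add (hv.comp continuous_snd)) ?_
    have h := hB.comp ((hv.comp continuous_fst).prodMk (hv.comp continuous_snd) :
      Continuous fun p : Heisenberg B × Heisenberg B => (p.1.vec, p.2.vec))
    simp only [cen_mul, div_eq_mul_inv]
    exact ((ht.comp continuous_fst).add (ht.comp continuous_snd)).add (h.mul continuous_const)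
  · refine continuous_induced_rng.mpr ?_
    refine Continuous.prodMk hv.neg ?_
    have h := hB.comp (hv.prodMk hv : Continuous fun p : Heisenberg B => (p.vec, p.vec))
    simp only [cen_inv, div_eq_mul_inv]
    exact ht.neg.add (h.mul continuous_const)

end Heisenberg

/-! ### Heisenberg representations -/

section HeisenbergRep

variable {F R W V : Type*} [Field F] [Field R] [AddCommGroup W] [Module F W]
  [AddCommGroup V] [Module R V]

/-- The subgroup `F = {(0, t)}` of the Heisenberg group acts through `ψ`. -/
def HasCentralChar {B : LinearMap.BilinForm F W} (ψ : AddChar F R)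
    (ρ : Representation R (Heisenberg B) V) : Prop :=
  ∀ (t : F) (v : V), ρ ⟨0, t⟩ v = ψ t • v

/-- `ρ` is (a model of) the Heisenberg representation associated to `ψ`: it is a smooth
irreducible representation of the Heisenberg group with central character `ψ`. -/
structure IsHeisenbergRep [TopologicalSpace F] {B : LinearMap.BilinForm F W} (ψ : AddChar F R)
    (ρ : Representation R (Heisenberg B) V) : Prop where
  smooth : IsSmoothRep ρ
  irreducible : ρ.IsIrreducible
  central : HasCentralChar ψ ρ

/-- The orthogonal sum of two bilinear forms. -/
def orthogonalSum {W₁ W₂ : Type*} [AddCommGroup W₁] [Module F W₁] [AddCommGroup W₂] [Module F W₂]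
    (B₁ : LinearMap.BilinForm F W₁) (B₂ : LinearMap.BilinForm F W₂) :
    LinearMap.BilinForm F (W₁ × W₂) :=
  B₁.compl₁₂ (LinearMap.fst F W₁ W₂) (LinearMap.fst F W₁ W₂) +
    B₂.compl₁₂ (LinearMap.snd F W₁ W₂) (LinearMap.snd F W₁ W₂)

@[simp] theorem orthogonalSum_apply {W₁ W₂ : Type*} [AddCommGroup W₁] [Module F W₁]
    [AddCommGroup W₂] [Module F W₂] (B₁ : LinearMap.BilinForm F W₁)
    (B₂ : LinearMap.BilinForm F W₂) (x y : W₁ × W₂) :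
    orthogonalSum B₁ B₂ x y = B₁ x.1 y.1 + B₂ x.2 y.2 := rfl

theorem HasCentralChar.mul_vec {B : LinearMap.BilinForm F W} {ψ : AddChar F R}
    {ρ : Representation R (Heisenberg B) V} (h : HasCentralChar ψ ρ) (w w' : W) :
    ρ ⟨w, 0⟩ * ρ ⟨w', 0⟩ = ψ (B w w' / 2) • ρ ⟨w + w', 0⟩ := by
  have e : (⟨w, 0⟩ * ⟨w', 0⟩ : Heisenberg B) = ⟨0, B w w' / 2⟩ * ⟨w + w', 0⟩ := by
    ext <;> simp
  rw [← map_mul, e, map_mul]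
  ext v
  exact h _ _

/-- The representation `(w₁ + w₂, t) ↦ ψ t • (ρ₁ (w₁, 0) ⊗ ρ₂ (w₂, 0))` of the Heisenberg group of
an orthogonal sum on the tensor product of two representations with central character `ψ`. -/
noncomputable def heisenbergTensor {W₁ W₂ V₁ V₂ : Type*} [AddCommGroup W₁] [Module F W₁]
    [AddCommGroup W₂] [Module F W₂] [AddCommGroup V₁] [Module R V₁] [AddCommGroup V₂] [Module R V₂]
    {B₁ : LinearMap.BilinForm F W₁} {B₂ : LinearMap.BilinForm F W₂} (ψ : AddChar F R)
    (ρ₁ : Representation R (Heisenberg B₁) V₁) (ρ₂ : Representation R (Heisenberg B₂) V₂)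
    (h₁ : HasCentralChar ψ ρ₁) (h₂ : HasCentralChar ψ ρ₂) :
    Representation R (Heisenberg (orthogonalSum B₁ B₂)) (V₁ ⊗[R] V₂) where
  toFun x := ψ x.cen • TensorProduct.map (ρ₁ ⟨x.vec.1, 0⟩) (ρ₂ ⟨x.vec.2, 0⟩)
  map_one' := by
    have e₁ : ρ₁ ⟨0, 0⟩ = 1 := map_one ρ₁
    have e₂ : ρ₂ ⟨0, 0⟩ = 1 := map_one ρ₂
    simp [e₁, e₂]
  map_mul' x y := by
    rw [smul_mul_smul_comm, ← TensorProduct.map_mul, h₁.mul_vec, h₂.mul_vec,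
      TensorProduct.map_smul_left, TensorProduct.map_smul_right, smul_smul, smul_smul]
    simp only [Heisenberg.cen_mul, Heisenberg.vec_mul, orthogonalSum_apply, Prod.fst_add,
      Prod.snd_add, add_div, AddChar.map_add_eq_mul, mul_assoc]

end HeisenbergRep

/-!
The proof rests on a compact open subgroup `L` of `W` that is its own annihilator for the
bicharacter `ψ (B w w')`, and on a section `l ↦ (l, q l)` over `L` that becomes a homomorphism to
the Heisenberg group modulo the kernel of `ψ`. Both are recorded in `LagrangianDatum`. In dimension
two `L` is `I × J`, where `I` and `J` are subgroups of `F` that are each other's annihilator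
(`exists_isDualPair`): the ring of integers and a fractional ideal if `F` is local, `F` and `0` if
`F` is finite. Splitting off hyperbolic planes gives the general case (`exists_lagrangianDatum`).

Let `V` be a smooth representation with central character `ψ`, and let `V^L` be its subspace of
vectors fixed by `L`. Two facts carry all parts of the theorem.

* Fourier inversion (`LagrangianDatum.exists_eq_sum`): a vector `v` fixed by a small subgroup `K`
  of `L` is a sum of translates, by representatives of the finite group `K^⊥ / L`, of elements of
  `V^L` that lie in every subrepresentation containing `v`. Hence `V` is generated by `V^L`, and
  every nonzero subrepresentation meets `V^L`.
* For `v` in `V^L` the subrepresentation generated by `v` meets `V^L` only in the line of `v`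
  (`LagrangianDatum.mem_span_of_mem_cyclicSubrep`). A translate of `v` by `w` outside `L` is an
  eigenvector of `L` for a nontrivial character and so vanishes in the coinvariants, while `V^L`
  embeds in the coinvariants because `L` acts on each vector through a finite group of invertible
  order. That order is invertible since `R` contains enough roots of unity to separate the elements
  of the group (`natCast_card_cosetReps_ne_zero`).

So every nonzero vector of `V^L` generates an irreducible subrepresentation. This gives
semisimplicity, and shows that `V` is irreducible as soon as it is generated by one nonzero vector
of `V^L`; for an irreducible `V`, the space `V^L` is a line. The criterion applies to `1 ⊗ v` in an
extension of scalars and to `v₁ ⊗ v₂` in the tensor product for an orthogonal sum. Uniqueness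
follows by applying it to the subrepresentation of a direct sum generated by a pair of fixed
vectors, Schur's lemma by evaluating an endomorphism at a vector that spans `V^L`, and admissibility
from Fourier inversion. In the contragredient the functionals fixed by `L` vanish on the kernel of
`V → V_L`, and `V_L` is a line, so that they form a line as well.
-/

/-! ### Annihilators for a character and a bilinear form -/

section CharPerp

variable {F R W : Type*} [Field F] [Field R] [AddCommGroup W] [Module F W]

/-- The left annihilator of a subgroup `K` for the bicharacter `(w, k) ↦ ψ (B w k)`. -/
def charPerp (ψ : AddChar F R) (B : LinearMap.BilinForm F W) (K : AddSubgroup W) :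
    AddSubgroup W where
  carrier := {w | ∀ k ∈ K, ψ (B w k) = 1}
  add_mem' := by
    intro a b ha hb k hk
    simp [AddChar.map_add_eq_mul, ha k hk, hb k hk]
  zero_mem' := by intro k _; simp
  neg_mem' := by
    intro a ha k hk
    simp [AddChar.map_neg_eq_inv, ha k hk]

variable {ψ : AddChar F R} {B : LinearMap.BilinForm F W}

theorem mem_charPerp {K : AddSubgroup W} {w : W} :
    w ∈ charPerp ψ B K ↔ ∀ k ∈ K, ψ (B w k) = 1 := Iff.rfl

theorem isAlt_swap (hB : B.IsAlt) (x y : W) : B x y = -B y x :=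
  (LinearMap.IsAlt.neg hB y x).symm

theorem addChar_eq_iff {A : Type*} [AddCommGroup A] (χ : AddChar A R) (a b : A) :
    χ a = χ b ↔ χ (a - b) = 1 := by
  rw [AddChar.map_sub_eq_div, div_eq_one_iff_eq (χ.val_isUnit b).ne_zero]

theorem charPerp_prod {W₁ W₂ : Type*} [AddCommGroup W₁] [Module F W₁] [AddCommGroup W₂]
    [Module F W₂] {B₁ : LinearMap.BilinForm F W₁} {B₂ : LinearMap.BilinForm F W₂}
    (K₁ : AddSubgroup W₁) (K₂ : AddSubgroup W₂) :
    charPerp ψ (orthogonalSum B₁ B₂) (K₁.prod K₂) = (charPerp ψ B₁ K₁).prod (charPerp ψ B₂ K₂) := by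
  ext w
  simp only [AddSubgroup.mem_prod, mem_charPerp]
  constructor
  · intro h
    exact ⟨fun k hk => by simpa using h (k, 0) ⟨hk, K₂.zero_mem⟩,
      fun k hk => by simpa using h (0, k) ⟨K₁.zero_mem, hk⟩⟩
  · rintro ⟨h₁, h₂⟩ k ⟨hk₁, hk₂⟩
    rw [orthogonalSum_apply, AddChar.map_add_eq_mul, h₁ _ hk₁, h₂ _ hk₂, one_mul]

/-- The symplectic plane, with `B ((a, b), (c, d)) = a * d - b * c`. -/
def planeForm (F : Type*) [Field F] : LinearMap.BilinForm F (F × F) :=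
  (LinearMap.mul F F).compl₁₂ (LinearMap.fst F F F) (LinearMap.snd F F F) -
    (LinearMap.mul F F).compl₁₂ (LinearMap.snd F F F) (LinearMap.fst F F F)

@[simp] theorem planeForm_apply (x y : F × F) :
    planeForm F x y = x.1 * y.2 - x.2 * y.1 := rfl

theorem charPerp_planeForm (K₁ K₂ : AddSubgroup F) :
    charPerp ψ (planeForm F) (K₁.prod K₂) =
      (charPerp ψ (LinearMap.mul F F) K₂).prod (charPerp ψ (LinearMap.mul F F) K₁) := by
  ext w
  simp only [AddSubgroup.mem_prod, mem_charPerp]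
  constructor
  · intro h
    exact ⟨fun k hk => by simpa using h (0, k) ⟨K₁.zero_mem, hk⟩,
      fun k hk => by simpa [AddChar.map_neg_eq_inv] using h (k, 0) ⟨hk, K₂.zero_mem⟩⟩
  · rintro ⟨h₁, h₂⟩ k ⟨hk₁, hk₂⟩
    have h₁ := h₁ _ hk₂
    have h₂ := h₂ _ hk₁
    rw [LinearMap.mul_apply'] at h₁ h₂
    rw [planeForm_apply, AddChar.map_sub_eq_div, h₁, h₂, div_one]

end CharPerp

/-! ### Compact open subgroups of the base field in duality -/

section BaseField

variable {F R : Type*} [Field F] [Field R]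

theorem mem_charPerp_mul {ψ : AddChar F R} {K : AddSubgroup F} {y : F} :
    y ∈ charPerp ψ (LinearMap.mul F F) K ↔ ∀ k ∈ K, ψ (y * k) = 1 := Iff.rfl

/-- Scaling a subgroup of a field by a nonzero element. -/
def scaleSubgroup (a : F) (K : AddSubgroup F) : AddSubgroup F :=
  K.comap (AddMonoidHom.mulLeft a⁻¹)

theorem mem_scaleSubgroup {a x : F} {K : AddSubgroup F} :
    x ∈ scaleSubgroup a K ↔ a⁻¹ * x ∈ K := Iff.rfl

theorem charPerp_scaleSubgroup (ψ : AddChar F R) {a : F} (ha : a ≠ 0) (K : AddSubgroup F) :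
    charPerp ψ (LinearMap.mul F F) (scaleSubgroup a K) =
      scaleSubgroup a⁻¹ (charPerp ψ (LinearMap.mul F F) K) := by
  ext y
  simp only [mem_charPerp_mul, mem_scaleSubgroup, inv_inv]
  constructor
  · intro h k hk
    have := h (a * k) (by rwa [inv_mul_cancel_left₀ ha])
    rwa [mul_comm a y, mul_assoc]
  · intro h k hk
    have := h _ hk
    rwa [show a * y * (a⁻¹ * k) = y * k by field_simp] at this

variable [TopologicalSpace F]

/-- Two compact open subgroups of `F` that are each other's annihilator for `ψ (x * y)`, together
with a neighbourhood basis of open subgroups that are closed under double annihilators. -/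
structure IsDualPair (ψ : AddChar F R) (I J : AddSubgroup F) : Prop where
  charPerp_left : charPerp ψ (LinearMap.mul F F) I = J
  charPerp_right : charPerp ψ (LinearMap.mul F F) J = I
  isOpen_left : IsOpen (I : Set F)
  isOpen_right : IsOpen (J : Set F)
  isCompact_left : IsCompact (I : Set F)
  isCompact_right : IsCompact (J : Set F)
  basis : ∀ N ∈ nhds (0 : F), ∃ K : AddSubgroup F, (K : Set F) ⊆ N ∧ IsOpen (K : Set F) ∧
    charPerp ψ (LinearMap.mul F F) (charPerp ψ (LinearMap.mul F F) K) = K ∧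
    IsCompact (charPerp ψ (LinearMap.mul F F) K : Set F)

theorem exists_isDualPair_of_finite [Finite F] [DiscreteTopology F] {ψ : AddChar F R}
    (hψ1 : ψ ≠ 1) : ∃ I J : AddSubgroup F, IsDualPair ψ I J := by
  have h1 : charPerp ψ (LinearMap.mul F F) ⊤ = ⊥ := by
    rw [eq_bot_iff]
    intro y hy
    by_contra hy0
    refine hψ1 ?_
    ext x
    have := hy (y⁻¹ * x) trivial
    simpa [mul_inv_cancel_left₀ (show y ≠ 0 from hy0)] using this
  have h2 : charPerp ψ (LinearMap.mul F F) ⊥ = ⊤ := by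
    rw [eq_top_iff]
    intro y _ k hk
    simp [AddSubgroup.mem_bot.mp hk]
  exact ⟨⊤, ⊥, h1, h2, isOpen_discrete _, isOpen_discrete _, Set.toFinite _ |>.isCompact,
    Set.toFinite _ |>.isCompact, fun N hN => ⟨⊥, by simpa using mem_of_mem_nhds hN,
      isOpen_discrete _, by rw [h2, h1], Set.toFinite _ |>.isCompact⟩⟩

open ValuativeRel in
theorem exists_isDualPair_of_local [IsTopologicalRing F] [ValuativeRel F]
    [IsNonarchimedeanLocalField F] {ψ : AddChar F R} (hψ : IsSmoothAddChar ψ) (hψ1 : ψ ≠ 1) :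
    ∃ I J : AddSubgroup F, IsDualPair ψ I J := by
  set v := valuation F with hv
  have arch : MulArchimedean (ValueGroupWithZero F) :=
    .comap (IsNonarchimedeanLocalField.valueGroupWithZeroIsoInt F).toMonoidHom
      (IsNonarchimedeanLocalField.valueGroupWithZeroIsoInt F).strictMono
  let O : AddSubgroup F := (v.integer).toAddSubgroup
  have mem_O : ∀ x, x ∈ O ↔ v x ≤ 1 := fun x => Iff.rfl
  have small : ∀ N ∈ nhds (0 : F), ∃ a : F, a ≠ 0 ∧ (scaleSubgroup a O : Set F) ⊆ N := by
    intro N hN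
    obtain ⟨r, hr, hrs⟩ := (IsValuativeTopology.hasBasis_nhds_zero' F).mem_iff.mp hN
    obtain ⟨s, rfl⟩ := ValuativeRel.valuation_surjective r
    obtain ⟨c, hc0, hc1⟩ := Valuation.IsNontrivial.exists_lt_one (v := v)
    have hs : s ≠ 0 := by simpa using hr
    refine ⟨s * c, mul_ne_zero hs (by simpa using hc0), fun x hx => hrs ?_⟩
    have hx' : v ((s * c)⁻¹ * x) ≤ 1 := hx
    have hsc : s * c ≠ 0 := mul_ne_zero hs (by simpa using hc0)
    have hvs : 0 < v s := zero_lt_iff.mpr (by simpa using hs)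
    calc v x = v (s * c) * v ((s * c)⁻¹ * x) := by rw [← map_mul, mul_inv_cancel_left₀ hsc]
      _ ≤ v (s * c) * 1 := by gcongr
      _ = v s * v c := by simp
      _ < v s * 1 := by gcongr
      _ = v s := mul_one _
  have hOopen : IsOpen (O : Set F) := by
    refine O.isOpen_of_mem_nhds (g := 0) ?_
    rw [(IsValuativeTopology.hasBasis_nhds_zero' F).mem_iff]
    exact ⟨1, one_ne_zero, fun x hx => (mem_O x).mpr (le_of_lt hx)⟩
  have hOc : IsCompact (O : Set F) := IsNonarchimedeanLocalField.isCompact_closedBall F 1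
  have scale_open : ∀ a : F, a ≠ 0 → ∀ K : AddSubgroup F, IsOpen (K : Set F) →
      IsOpen (scaleSubgroup a K : Set F) := fun a _ K hK =>
    hK.preimage (continuous_const_mul a⁻¹)
  have scale_compact : ∀ a : F, a ≠ 0 → ∀ K : AddSubgroup F, IsCompact (K : Set F) →
      IsCompact (scaleSubgroup a K : Set F) := fun a ha K hK =>
    (Homeomorph.mulLeft₀ a⁻¹ (inv_ne_zero ha)).isCompact_preimage.mpr hK
  let J := charPerp ψ (LinearMap.mul F F) O
  -- annihilators of `O`-modules are `O`-modules
  have perp_smul : ∀ (K : AddSubgroup F), (∀ c ∈ O, ∀ k ∈ K, c * k ∈ K) → ∀ c ∈ O,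
      ∀ y ∈ charPerp ψ (LinearMap.mul F F) K, c * y ∈ charPerp ψ (LinearMap.mul F F) K := by
    intro K hK c hc y hy k hk
    have := hy (c * k) (hK c hc k hk)
    rw [LinearMap.mul_apply'] at this ⊢
    rwa [show c * y * k = y * (c * k) by ring]
  have O_mul : ∀ c ∈ O, ∀ k ∈ O, c * k ∈ O := fun c hc k hk => v.integer.mul_mem hc hk
  have J_smul := perp_smul O O_mul
  have of_le : ∀ (K : AddSubgroup F), (∀ c ∈ O, ∀ k ∈ K, c * k ∈ K) → ∀ x y, y ∈ K →
      v x ≤ v y → x ∈ K := by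
    intro K hK x y hy hxy
    by_cases hy0 : y = 0
    · have : x = 0 := by simpa [hy0] using hxy
      rw [this]; exact K.zero_mem
    · have := hK (x / y) (by
        rw [mem_O, map_div₀]; exact div_le_one_of_le₀ hxy zero_le) y hy
      rwa [div_mul_cancel₀ _ hy0] at this
  obtain ⟨a, ha0, ha⟩ := small {t : F | ψ t = 1} (hψ.mem_nhds (by simp))
  have haJ : (scaleSubgroup a O : AddSubgroup F) ≤ J := by
    intro y hy k hk
    refine ha ?_
    change a⁻¹ * (y * k) ∈ O
    rw [← mul_assoc]
    exact O_mul _ hy k hk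
  have hJopen : IsOpen (J : Set F) := AddSubgroup.isOpen_mono haJ (scale_open a ha0 O hOopen)
  obtain ⟨y₀, hy₀⟩ : ∃ y₀, ψ y₀ ≠ 1 := by
    by_contra! h
    exact hψ1 (by ext x; simpa using h x)
  have hy₀J : y₀ ∉ J := fun h => hy₀ (by simpa using h 1 (by simp [mem_O]))
  have hJle : ∀ y ∈ J, v y ≤ v y₀ := by
    intro y hy
    by_contra! h
    exact hy₀J (of_le J J_smul _ y hy h.le)
  have hJc : IsCompact (J : Set F) :=
    (IsNonarchimedeanLocalField.isCompact_closedBall F (v y₀)).of_isClosed_subset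
      (J.isClosed_of_isOpen hJopen) hJle
  -- an element of the double annihilator outside `O` would scale `J` to itself
  have hJ : charPerp ψ (LinearMap.mul F F) J = O := by
    refine le_antisymm ?_ fun x hx y hy => by
      rw [LinearMap.mul_apply', mul_comm]; exact hy x hx
    intro x hx
    by_contra hxO
    rw [mem_O, not_le] at hxO
    have step : ∀ y ∈ J, x * y ∈ J := by
      intro y hy c hc
      have := hx (c * y) (J_smul c hc y hy)
      rw [LinearMap.mul_apply'] at this ⊢
      rwa [show x * y * c = x * (c * y) by ring]
    have haJ' : a ∈ J := haJ (by
      rw [mem_scaleSubgroup, inv_mul_cancel₀ ha0, mem_O, map_one])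
    have pow : ∀ n : ℕ, x ^ n * a ∈ J := by
      intro n
      induction n with
      | zero => simpa using haJ'
      | succ n ih => rw [pow_succ', mul_assoc]; exact step _ ih
    obtain ⟨n, hn⟩ := arch.arch (v (y₀ / a)) hxO
    have hva : 0 < v a := zero_lt_iff.mpr (by simpa using ha0)
    have h1 : v y₀ ≤ v (x ^ n * a) := by
      rw [map_mul, map_pow]
      rwa [map_div₀, div_le_iff₀ hva] at hn
    exact hy₀J (of_le J J_smul _ _ (pow n) h1)
  refine ⟨O, J, rfl, hJ, hOopen, hJopen, hOc, hJc, fun N hN => ?_⟩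
  obtain ⟨b, hb0, hb⟩ := small N hN
  refine ⟨scaleSubgroup b O, hb, scale_open b hb0 O hOopen, ?_, ?_⟩
  · rw [charPerp_scaleSubgroup ψ hb0, charPerp_scaleSubgroup ψ (inv_ne_zero hb0), inv_inv]
    exact congrArg _ hJ
  · rw [charPerp_scaleSubgroup ψ hb0]
    exact scale_compact _ (inv_ne_zero hb0) J hJc

theorem exists_isDualPair [IsTopologicalRing F] (hF : IsFiniteOrNonarchimedeanLocal F)
    {ψ : AddChar F R} (hψ : IsSmoothAddChar ψ) (hψ1 : ψ ≠ 1) :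
    ∃ I J : AddSubgroup F, IsDualPair ψ I J := by
  obtain ⟨_, _⟩ | ⟨_, _⟩ := hF
  · exact exists_isDualPair_of_finite hψ1
  · exact exists_isDualPair_of_local hψ hψ1

end BaseField

/-! ### Self-dual lattices in a symplectic space -/

section Lagrangian

variable {F R : Type*} [Field F] [Field R] [TopologicalSpace F]

/-- A compact open subgroup `L` of `W` that is its own annihilator for `ψ (B w w')`, together with
a function `q` for which `l ↦ (l, q l)` is, up to the kernel of `ψ`, a homomorphism from `L` to the
Heisenberg group. Dividing by two may not preserve `L`, so `q = 0` is not always possible. The last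
field is a neighbourhood basis of subgroups that are their own double annihilators. -/
structure LagrangianDatum {W : Type*} [AddCommGroup W] [Module F W] [TopologicalSpace W]
    (ψ : AddChar F R) (B : LinearMap.BilinForm F W) where
  /-- the self-dual subgroup -/
  L : AddSubgroup W
  /-- the central coordinate of the section over `L` -/
  q : W → F
  charPerp_eq : charPerp ψ B L = L
  isOpen : IsOpen (L : Set W)
  isCompact : IsCompact (L : Set W)
  continuous_q : Continuous q
  q_zero : q 0 = 0
  q_add : ∀ l ∈ L, ∀ l' ∈ L, ψ (q (l + l')) = ψ (q l + q l' + B l l' / 2)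
  basis : ∀ N ∈ nhds (0 : W), ∃ K : AddSubgroup W, (K : Set W) ⊆ N ∧ IsOpen (K : Set W) ∧
    charPerp ψ B (charPerp ψ B K) = K ∧ IsCompact (charPerp ψ B K : Set W)

variable {W W₁ W₂ : Type*} [AddCommGroup W] [Module F W] [TopologicalSpace W]
  [AddCommGroup W₁] [Module F W₁] [TopologicalSpace W₁]
  [AddCommGroup W₂] [Module F W₂] [TopologicalSpace W₂]
  {ψ : AddChar F R} {B : LinearMap.BilinForm F W}
  {B₁ : LinearMap.BilinForm F W₁} {B₂ : LinearMap.BilinForm F W₂}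

namespace LagrangianDatum

/-- The same lattice serves every character with the same kernel as `ψ`, in any coefficient
field. -/
def ofKer {R' : Type*} [Field R'] {ψ' : AddChar F R'} (h : ∀ t, ψ' t = 1 ↔ ψ t = 1)
    (D : LagrangianDatum ψ B) : LagrangianDatum ψ' B :=
  have e : charPerp ψ' B = charPerp ψ B := by
    ext K w
    simp [mem_charPerp, h]
  { L := D.L
    q := D.q
    charPerp_eq := e ▸ D.charPerp_eq
    isOpen := D.isOpen
    isCompact := D.isCompact
    continuous_q := D.continuous_q
    q_zero := D.q_zero
    q_add := fun l hl l' hl' => by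
      rw [addChar_eq_iff, h, ← addChar_eq_iff]
      exact D.q_add l hl l' hl'
    basis := e ▸ D.basis }

/-- The lattice `L₁ ⊕ L₂` in an orthogonal sum. -/
def prod [IsTopologicalRing F] (D₁ : LagrangianDatum ψ B₁) (D₂ : LagrangianDatum ψ B₂) :
    LagrangianDatum ψ (orthogonalSum B₁ B₂) where
  L := D₁.L.prod D₂.L
  q w := D₁.q w.1 + D₂.q w.2
  charPerp_eq := by rw [charPerp_prod, D₁.charPerp_eq, D₂.charPerp_eq]
  isOpen := D₁.isOpen.prod D₂.isOpen
  isCompact := D₁.isCompact.prod D₂.isCompact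
  continuous_q := (D₁.continuous_q.comp continuous_fst).add (D₂.continuous_q.comp continuous_snd)
  q_zero := by simp [D₁.q_zero, D₂.q_zero]
  q_add l hl l' hl' := by
    have h₁ := D₁.q_add _ hl.1 _ hl'.1
    have h₂ := D₂.q_add _ hl.2 _ hl'.2
    simp only [orthogonalSum_apply, Prod.fst_add, Prod.snd_add, AddChar.map_add_eq_mul, add_div]
      at h₁ h₂ ⊢
    rw [h₁, h₂]
    ring
  basis N hN := by
    obtain ⟨N₁, hN₁, N₂, hN₂, hN'⟩ := mem_nhds_prod_iff.mp hN
    obtain ⟨K₁, hK₁, ho₁, hd₁, hc₁⟩ := D₁.basis N₁ hN₁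
    obtain ⟨K₂, hK₂, ho₂, hd₂, hc₂⟩ := D₂.basis N₂ hN₂
    refine ⟨K₁.prod K₂, fun x hx => hN' ⟨hK₁ hx.1, hK₂ hx.2⟩, ho₁.prod ho₂, ?_, ?_⟩
    · rw [charPerp_prod, charPerp_prod, hd₁, hd₂]
    · rw [charPerp_prod]
      exact hc₁.prod hc₂

/-- Transport of a self-dual lattice along an isometry. -/
def congr [IsTopologicalRing F] [IsModuleTopology F W] [IsModuleTopology F W₁]
    (e : W₁ ≃ₗ[F] W) (he : ∀ x y, B (e x) (e y) = B₁ x y) (D : LagrangianDatum ψ B₁) :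
    LagrangianDatum ψ B :=
  have : ContinuousAdd W := IsModuleTopology.toContinuousAdd F W
  have : ContinuousAdd W₁ := IsModuleTopology.toContinuousAdd F W₁
  have cs : Continuous e.symm := IsModuleTopology.continuous_of_linearMap e.symm.toLinearMap
  have ce : Continuous e := IsModuleTopology.continuous_of_linearMap e.toLinearMap
  have compact : ∀ K : AddSubgroup W₁, IsCompact (K : Set W₁) →
      IsCompact (K.comap e.symm.toLinearMap.toAddMonoidHom : Set W) := fun K hK => by
    have h := hK.image ce
    convert! h using 1
    exact (e.toEquiv.image_eq_preimage_symm _).symm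
  have perp : ∀ K : AddSubgroup W₁, charPerp ψ B (K.comap e.symm.toLinearMap.toAddMonoidHom) =
      (charPerp ψ B₁ K).comap e.symm.toLinearMap.toAddMonoidHom := fun K => by
    ext w
    constructor
    · intro h k hk
      have := h (e k) (by simpa using hk)
      rw [← he]
      simpa using this
    · intro h k hk
      have := h (e.symm k) hk
      rw [← he] at this
      simpa using this
  { L := D.L.comap e.symm.toLinearMap.toAddMonoidHom
    q := fun w => D.q (e.symm w)
    charPerp_eq := by rw [perp, D.charPerp_eq]
    isOpen := D.isOpen.preimage cs
    isCompact := compact _ D.isCompact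
    continuous_q := D.continuous_q.comp cs
    q_zero := by simp [D.q_zero]
    q_add := fun l hl l' hl' => by
      have := D.q_add _ hl _ hl'
      simp only [← he] at this
      simpa using this
    basis := fun N hN => by
      obtain ⟨K, hK, ho, hd, hc⟩ := D.basis (e ⁻¹' N) (ce.continuousAt.preimage_mem_nhds (by simpa))
      refine ⟨K.comap e.symm.toLinearMap.toAddMonoidHom, fun x hx => ?_, ho.preimage cs, ?_, ?_⟩
      · have := hK hx
        simpa using this
      · rw [perp, perp, hd]
      · rw [perp]
        exact compact _ hc }

/-- In the trivial space the lattice is everything. -/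
def ofSubsingleton [Subsingleton W] : LagrangianDatum ψ B where
  L := ⊤
  q _ := 0
  charPerp_eq := by
    rw [eq_top_iff]
    intro w _ k _
    simp [Subsingleton.elim w 0]
  isOpen := isOpen_univ
  isCompact := Set.subsingleton_univ.isCompact
  continuous_q := continuous_const
  q_zero := rfl
  q_add l _ l' _ := by simp [Subsingleton.elim l 0]
  basis N hN := ⟨⊤, fun x _ => by rw [Subsingleton.elim x 0]; exact mem_of_mem_nhds hN,
    isOpen_univ, Subsingleton.elim _ _, (Set.subsingleton_of_subsingleton).isCompact⟩

end LagrangianDatum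

/-- For a dual pair `I`, `J` the product `I × J` is self-dual in the symplectic plane. -/
def IsDualPair.lagrangianDatum [IsTopologicalRing F] {I J : AddSubgroup F} (h : IsDualPair ψ I J)
    (hF2 : (2 : F) ≠ 0) : LagrangianDatum ψ (planeForm F) where
  L := I.prod J
  q w := w.1 * w.2 / 2
  charPerp_eq := by rw [charPerp_planeForm, h.charPerp_left, h.charPerp_right]
  isOpen := h.isOpen_left.prod h.isOpen_right
  isCompact := h.isCompact_left.prod h.isCompact_right
  continuous_q := by
    simp only [div_eq_mul_inv]
    fun_prop
  q_zero := by simp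
  q_add l hl l' hl' := by
    have key : ψ (l.2 * l'.1) = 1 := by
      have hl2 : l.2 ∈ J := hl.2
      rw [← h.charPerp_left] at hl2
      exact hl2 _ hl'.1
    have e : (l + l').1 * (l + l').2 / 2 =
        l.1 * l.2 / 2 + l'.1 * l'.2 / 2 + planeForm F l l' / 2 + l.2 * l'.1 := by
      simp only [Prod.fst_add, Prod.snd_add, planeForm_apply]
      field_simp
      ring
    rw [e, AddChar.map_add_eq_mul, key, mul_one]
  basis N hN := by
    obtain ⟨N₁, hN₁, N₂, hN₂, hN'⟩ := mem_nhds_prod_iff.mp hN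
    obtain ⟨K₁, hK₁, ho₁, hd₁, hc₁⟩ := h.basis N₁ hN₁
    obtain ⟨K₂, hK₂, ho₂, hd₂, hc₂⟩ := h.basis N₂ hN₂
    refine ⟨K₁.prod K₂, fun x hx => hN' ⟨hK₁ hx.1, hK₂ hx.2⟩, ho₁.prod ho₂, ?_, ?_⟩
    · rw [charPerp_planeForm, charPerp_planeForm, hd₁, hd₂]
    · rw [charPerp_planeForm]
      exact hc₂.prod hc₁

end Lagrangian

/-- A symplectic space with a vector pair `e`, `f` such that `B e f = 1` is the orthogonal sum of
the symplectic plane and the common annihilator of `e` and `f`. -/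
def splitPlane {F W : Type*} [Field F] [AddCommGroup W] [Module F W]
    {B : LinearMap.BilinForm F W} (hB : B.IsAlt) {e f : W} (hef : B e f = 1) :
    ((F × F) × (LinearMap.ker (B e) ⊓ LinearMap.ker (B f) : Submodule F W)) ≃ₗ[F] W where
  toFun x := x.1.1 • e + x.1.2 • f + x.2
  map_add' x y := by
    simp only [Prod.fst_add, Prod.snd_add, add_smul, Submodule.coe_add]
    abel
  map_smul' c x := by simp [mul_smul]
  invFun w := ((-B f w, B e w), ⟨w + B f w • e - B e w • f, by
    have hfe : B f e = -1 := by rw [isAlt_swap hB, hef]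
    simp [hef, hfe, hB.self_eq_zero]⟩)
  left_inv x := by
    obtain ⟨⟨a, b⟩, u, hu⟩ := x
    have hfe : B f e = -1 := by rw [isAlt_swap hB, hef]
    have h₁ : B e u = 0 := hu.1
    have h₂ : B f u = 0 := hu.2
    ext
    · simp [hfe, hB.self_eq_zero, h₂]
    · simp [hef, hB.self_eq_zero, h₁]
    · simp only [map_add, map_smul, hef, hfe, hB.self_eq_zero, h₁, h₂, smul_eq_mul]
      module
  right_inv w := by simp

theorem splitPlane_isometry {F W : Type*} [Field F] [AddCommGroup W] [Module F W]
    {B : LinearMap.BilinForm F W} (hB : B.IsAlt) {e f : W} (hef : B e f = 1)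
    (x y : (F × F) × (LinearMap.ker (B e) ⊓ LinearMap.ker (B f) : Submodule F W)) :
    B (splitPlane hB hef x) (splitPlane hB hef y) =
      orthogonalSum (planeForm F) (B.restrict (LinearMap.ker (B e) ⊓ LinearMap.ker (B f))) x y := by
  obtain ⟨⟨a, b⟩, u, hu⟩ := x
  obtain ⟨⟨c, d⟩, u', hu'⟩ := y
  have hfe : B f e = -1 := by rw [isAlt_swap hB, hef]
  have h₁ : B e u' = 0 := hu'.1
  have h₂ : B f u' = 0 := hu'.2
  have h₃ : B u e = 0 := by rw [isAlt_swap hB, show B e u = 0 from hu.1, neg_zero]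
  have h₄ : B u f = 0 := by rw [isAlt_swap hB, show B f u = 0 from hu.2, neg_zero]
  simp [splitPlane, hef, hfe, hB.self_eq_zero, h₁, h₂, h₃, h₄]
  ring

theorem exists_lagrangianDatum {F R : Type*} [Field F] [Field R] [TopologicalSpace F]
    [IsTopologicalRing F] {ψ : AddChar F R} {I J : AddSubgroup F} (h : IsDualPair ψ I J)
    (hF2 : (2 : F) ≠ 0) (W : Type uW) [AddCommGroup W] [Module F W] [FiniteDimensional F W]
    (B : LinearMap.BilinForm F W) (hB : B.IsAlt) (hB' : B.Nondegenerate)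
    [TopologicalSpace W] [IsModuleTopology F W] : Nonempty (LagrangianDatum ψ B) := by
  suffices H : ∀ (n : ℕ) (W : Type uW) [AddCommGroup W] [Module F W] [FiniteDimensional F W]
      (B : LinearMap.BilinForm F W), B.IsAlt → B.Nondegenerate → Module.finrank F W = n →
      ∀ [TopologicalSpace W] [IsModuleTopology F W], Nonempty (LagrangianDatum ψ B) from
    H _ W B hB hB' rfl
  intro n
  induction n using Nat.strong_induction_on with
  | _ n ih =>
    intro W _ _ _ B hB hB' hn _ _
    cases subsingleton_or_nontrivial W
    · exact ⟨.ofSubsingleton⟩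
    obtain ⟨e, he⟩ := exists_ne (0 : W)
    obtain ⟨f₀, hf₀⟩ : ∃ f, B e f ≠ 0 := by
      by_contra! h0
      exact he (hB'.1 e h0)
    obtain ⟨f, hef⟩ : ∃ f, B e f = 1 := ⟨(B e f₀)⁻¹ • f₀, by simp [hf₀]⟩
    let U := LinearMap.ker (B e) ⊓ LinearMap.ker (B f)
    have heU : e ∉ U := by
      intro h
      have h2 : B f e = 0 := h.2
      rw [isAlt_swap hB, hef] at h2
      simp at h2
    have hlt : Module.finrank F U < n := hn ▸ Submodule.finrank_lt fun h => heU (h ▸ trivial)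
    have hU : (B.restrict U).IsAlt := fun u => hB u
    have hU' : (B.restrict U).Nondegenerate := by
      have hl : (B.restrict U).SeparatingLeft := by
        intro u hu
        have : (u : W) = 0 := hB'.1 _ fun w => by
          obtain ⟨x, rfl⟩ := (splitPlane hB hef).surjective w
          have := splitPlane_isometry hB hef ((0, 0), u) x
          have hu' := hu x.2
          simp only [orthogonalSum_apply] at this
          rw [show B.restrict U u x.2 = 0 from hu'] at this
          simpa [splitPlane] using this
        exact Subtype.ext this
      refine ⟨hl, fun u hu => hl u fun w => ?_⟩
      rw [isAlt_swap hU, hu w, neg_zero]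
    let _ : TopologicalSpace U := moduleTopology F U
    have : IsModuleTopology F U := ⟨rfl⟩
    obtain ⟨D⟩ := ih _ hlt U (B.restrict U) hU hU' rfl
    exact ⟨((h.lagrangianDatum hF2).prod D).congr (splitPlane hB hef)
      (splitPlane_isometry hB hef)⟩

/-! ### Sums over cosets -/

section CosetReps

variable {A M : Type*} [AddCommGroup A] [AddCommMonoid M] (P Q : AddSubgroup A)

/-- Representatives for the cosets in `Q / (P ∩ Q)`. -/
noncomputable def cosetReps [Finite (Q ⧸ P.addSubgroupOf Q)] : Finset A :=
  (Set.finite_range fun x : Q ⧸ P.addSubgroupOf Q => (x.out : A)).toFinset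

theorem finite_quotient_of_isOpen_of_isCompact [TopologicalSpace A] [IsTopologicalAddGroup A]
    (hP : IsOpen (P : Set A)) (hQ : IsCompact (Q : Set A)) :
    Finite (Q ⧸ P.addSubgroupOf Q) := by
  have : CompactSpace Q := isCompact_iff_compactSpace.mp hQ
  exact AddSubgroup.quotient_finite_of_isOpen _ (hP.preimage continuous_subtype_val)

variable {P Q}

theorem out_injective_coe :
    Function.Injective fun x : Q ⧸ P.addSubgroupOf Q => (x.out : A) :=
  Subtype.val_injective.comp Quotient.out_injective

theorem apply_out {X : Type*} {f : A → X} (hf : ∀ a ∈ Q, ∀ p ∈ P, p ∈ Q → f (a + p) = f a) (a : Q) :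
    f ((QuotientAddGroup.mk a : Q ⧸ P.addSubgroupOf Q).out : A) = f a := by
  obtain ⟨p, hp⟩ := QuotientAddGroup.mk_out_eq_add (P.addSubgroupOf Q) a
  rw [hp]
  exact hf a a.2 _ p.2 p.1.2

variable [Finite (Q ⧸ P.addSubgroupOf Q)]

theorem mem_of_mem_cosetReps {t : A} (ht : t ∈ cosetReps P Q) : t ∈ Q := by
  obtain ⟨x, rfl⟩ := (Set.Finite.mem_toFinset _).mp ht
  exact x.out.2

theorem sum_cosetReps [Fintype (Q ⧸ P.addSubgroupOf Q)] (f : A → M) :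
    ∑ t ∈ cosetReps P Q, f t = ∑ x : Q ⧸ P.addSubgroupOf Q, f (x.out : A) := by
  symm
  refine Finset.sum_bij (fun x _ => (x.out : A)) (fun x _ => ?_)
    (fun x _ y _ h => out_injective_coe h) (fun t ht => ?_) fun _ _ => rfl
  · exact (Set.Finite.mem_toFinset _).mpr ⟨x, rfl⟩
  · obtain ⟨x, rfl⟩ := (Set.Finite.mem_toFinset _).mp ht
    exact ⟨x, Finset.mem_univ _, rfl⟩

theorem card_cosetReps : (cosetReps P Q).card = Nat.card (Q ⧸ P.addSubgroupOf Q) := by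
  cases nonempty_fintype (Q ⧸ P.addSubgroupOf Q)
  rw [Finset.card_eq_sum_ones, sum_cosetReps, Nat.card_eq_fintype_card]
  simp

theorem sum_cosetReps_add_left {f : A → M}
    (hf : ∀ a ∈ Q, ∀ p ∈ P, p ∈ Q → f (a + p) = f a) {b : A} (hb : b ∈ Q) :
    ∑ t ∈ cosetReps P Q, f (b + t) = ∑ t ∈ cosetReps P Q, f t := by
  cases nonempty_fintype (Q ⧸ P.addSubgroupOf Q)
  rw [sum_cosetReps, sum_cosetReps]
  refine (Finset.sum_congr rfl fun x _ => ?_).trans (Equiv.sum_comp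
    (Equiv.addLeft (QuotientAddGroup.mk (⟨b, hb⟩ : Q) : Q ⧸ P.addSubgroupOf Q)) _)
  have e : (QuotientAddGroup.mk (⟨b, hb⟩ : Q) : Q ⧸ P.addSubgroupOf Q) + x =
      QuotientAddGroup.mk (⟨b, hb⟩ + x.out) := by
    rw [QuotientAddGroup.mk_add, QuotientAddGroup.out_eq' x]
  refine (Eq.trans (congrArg (fun y => f (Quotient.out y : Q)) e) (apply_out hf _)).symm

theorem sum_cosetReps_of_eq_zero {f : A → M}
    (hf : ∀ a ∈ Q, ∀ p ∈ P, p ∈ Q → f (a + p) = f a) (h0 : ∀ a ∈ Q, a ∉ P → f a = 0) :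
    ∑ t ∈ cosetReps P Q, f t = f 0 := by
  cases nonempty_fintype (Q ⧸ P.addSubgroupOf Q)
  rw [sum_cosetReps, Finset.sum_eq_single (QuotientAddGroup.mk (0 : Q))]
  · rw [apply_out hf]; rfl
  · intro x _ hx
    refine h0 _ x.out.2 fun h => hx ?_
    rw [← QuotientAddGroup.out_eq' x]
    exact (QuotientAddGroup.eq_zero_iff _).mpr h
  · simp

/-- If characters with values in a field `R` separate the elements of the finite group `Q / P`,
then the order of this group is invertible in `R`: a field of characteristic `ℓ` contains no
nontrivial `ℓ`-th root of unity. -/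
theorem natCast_card_cosetReps_ne_zero {R ι : Type*} [Field R] (χ : ι → AddChar A R)
    (h₁ : ∀ p ∈ P, ∀ i, χ i p = 1) (h₂ : ∀ a ∈ Q, (∀ i, χ i a = 1) → a ∈ P) :
    ((cosetReps P Q).card : R) ≠ 0 := by
  rw [card_cosetReps]
  intro h
  obtain ⟨ℓ, hℓ⟩ := CharP.exists R
  have hdvd := (CharP.cast_eq_zero_iff R ℓ _).mp h
  have hpos : Nat.card (Q ⧸ P.addSubgroupOf Q) ≠ 0 := Nat.card_pos.ne'
  have hprime : ℓ.Prime := (CharP.char_is_prime_or_zero R ℓ).resolve_right fun h0 => by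
    rw [h0, zero_dvd_iff] at hdvd
    exact hpos hdvd
  have : Fact ℓ.Prime := ⟨hprime⟩
  obtain ⟨x, hx⟩ := exists_prime_addOrderOf_dvd_card' ℓ hdvd
  obtain ⟨a, rfl⟩ := QuotientAddGroup.mk_surjective x
  have hℓa : ((ℓ • a : Q) : A) ∈ P := by
    have : ℓ • (QuotientAddGroup.mk a : Q ⧸ P.addSubgroupOf Q) = 0 := by
      rw [← hx]; exact addOrderOf_nsmul_eq_zero _
    exact (QuotientAddGroup.eq_zero_iff (ℓ • a)).mp this
  have haP : (a : A) ∈ P := h₂ a a.2 fun i => by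
    have := h₁ _ hℓa i
    rw [AddSubgroup.coe_nsmul, AddChar.map_nsmul_eq_pow] at this
    have h3 : (χ i a - 1) ^ ℓ = 0 := by rw [sub_pow_char, this, one_pow, sub_self]
    exact sub_eq_zero.mp (pow_eq_zero_iff hprime.ne_zero |>.mp h3)
  have : (QuotientAddGroup.mk a : Q ⧸ P.addSubgroupOf Q) = 0 :=
    (QuotientAddGroup.eq_zero_iff a).mpr haP
  rw [this, addOrderOf_zero] at hx
  exact hprime.one_lt.ne hx

end CosetReps

/-! ### Continuity in the Heisenberg group -/

namespace Heisenberg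

variable {F W : Type*} [Field F] [TopologicalSpace F] [AddCommGroup W] [Module F W]
  [TopologicalSpace W] [IsModuleTopology F W] {B : LinearMap.BilinForm F W}

theorem isInducing_vec_cen :
    Topology.IsInducing fun x : Heisenberg B => ((x.vec, x.cen) : W × F) := by
  refine ⟨?_⟩
  rw [eq_moduleTopology F W]
  rfl

theorem continuous_vec : Continuous fun x : Heisenberg B => x.vec :=
  continuous_fst.comp isInducing_vec_cen.continuous

theorem continuous_mk {X : Type*} [TopologicalSpace X] {f : X → W} {g : X → F}
    (hf : Continuous f) (hg : Continuous g) :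
    Continuous fun x => (⟨f x, g x⟩ : Heisenberg B) :=
  isInducing_vec_cen.continuous_iff.mpr (hf.prodMk hg)

end Heisenberg

theorem Heisenberg.continuous_cen {F W : Type*} [Field F] [TopologicalSpace F] [AddCommGroup W]
    [Module F W] {B : LinearMap.BilinForm F W} : Continuous fun x : Heisenberg B => x.cen :=
  letI : TopologicalSpace W := moduleTopology F W
  haveI : IsModuleTopology F W := ⟨rfl⟩
  continuous_snd.comp isInducing_vec_cen.continuous

theorem isTopologicalAddGroup_of_isModuleTopology (F W : Type*) [Field F] [TopologicalSpace F]
    [IsTopologicalRing F] [AddCommGroup W] [Module F W] [TopologicalSpace W]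
    [IsModuleTopology F W] : IsTopologicalAddGroup W :=
  have := IsModuleTopology.toContinuousAdd F W
  have := IsModuleTopology.continuousNeg F W
  ⟨⟩

/-! ### Cyclic subrepresentations -/

section Cyclic

variable {R G V : Type*} [Field R] [Group G] [AddCommGroup V] [Module R V]

/-- The subrepresentation generated by a vector. -/
def cyclicSubrep (ρ : Representation R G V) (v : V) : Subrepresentation ρ where
  toSubmodule := Submodule.span R (Set.range fun g => ρ g v)
  apply_mem_toSubmodule g u hu := by
    induction hu using Submodule.span_induction with
    | mem x hx =>
      obtain ⟨h, rfl⟩ := hx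
      exact Submodule.subset_span ⟨g * h, by simp⟩
    | zero => simp
    | add x y _ _ hx hy => rw [map_add]; exact add_mem hx hy
    | smul c x _ hx => rw [map_smul]; exact Submodule.smul_mem _ c hx

theorem apply_mem_cyclicSubrep (ρ : Representation R G V) (g : G) (v : V) :
    ρ g v ∈ cyclicSubrep ρ v := Submodule.subset_span ⟨g, rfl⟩

theorem mem_cyclicSubrep (ρ : Representation R G V) (v : V) : v ∈ cyclicSubrep ρ v := by
  simpa using apply_mem_cyclicSubrep ρ 1 v

theorem cyclicSubrep_le {ρ : Representation R G V} {v : V} {N : Subrepresentation ρ}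
    (h : v ∈ N) : cyclicSubrep ρ v ≤ N := by
  refine Submodule.span_le (p := N.toSubmodule) |>.mpr ?_
  rintro _ ⟨g, rfl⟩
  exact N.apply_mem_toSubmodule g h

end Cyclic

/-! ### Vectors fixed by a self-dual lattice -/

namespace LagrangianDatum

section Lattice

variable {F R W : Type*} [Field F] [Field R] [AddCommGroup W] [Module F W]
  [TopologicalSpace F] [TopologicalSpace W] {ψ : AddChar F R} {B : LinearMap.BilinForm F W}
  (D : LagrangianDatum ψ B)

/-- The section of the Heisenberg group over the lattice. -/
def lift (w : W) : Heisenberg B := ⟨w, D.q w⟩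

/-- Open subgroups of the lattice that are their own double annihilators. -/
structure IsSmall (K : AddSubgroup W) : Prop where
  le : K ≤ D.L
  isOpen : IsOpen (K : Set W)
  charPerp_charPerp : charPerp ψ B (charPerp ψ B K) = K
  isCompact_charPerp : IsCompact (charPerp ψ B K : Set W)

theorem apply_eq_one {l l' : W} (hl : l ∈ D.L) (hl' : l' ∈ D.L) : ψ (B l l') = 1 := by
  rw [← D.charPerp_eq] at hl
  exact hl l' hl'

variable [IsTopologicalRing F] [IsModuleTopology F W]

variable {D} in
theorem IsSmall.finite_quotient {K : AddSubgroup W} (hK : D.IsSmall K) :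
    Finite (D.L ⧸ K.addSubgroupOf D.L) :=
  have := isTopologicalAddGroup_of_isModuleTopology F W
  finite_quotient_of_isOpen_of_isCompact K D.L hK.isOpen D.isCompact

variable {D} in
theorem IsSmall.finite_quotient_charPerp {K : AddSubgroup W} (hK : D.IsSmall K) :
    Finite (charPerp ψ B K ⧸ D.L.addSubgroupOf (charPerp ψ B K)) :=
  have := isTopologicalAddGroup_of_isModuleTopology F W
  finite_quotient_of_isOpen_of_isCompact D.L _ D.isOpen hK.isCompact_charPerp

omit [IsTopologicalRing F] in
theorem exists_isSmall {N : Set (Heisenberg B)} (hN : N ∈ nhds 1) :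
    ∃ K, D.IsSmall K ∧ ∀ k ∈ K, D.lift k ∈ N := by
  have hcont : Continuous D.lift := Heisenberg.continuous_mk continuous_id D.continuous_q
  have h0 : D.lift 0 = 1 := Heisenberg.ext rfl D.q_zero
  have hN' : D.lift ⁻¹' N ∈ nhds 0 := hcont.continuousAt.preimage_mem_nhds (by rwa [h0])
  obtain ⟨K, hK, ho, hd, hc⟩ := D.basis _ (Filter.inter_mem hN' (D.isOpen.mem_nhds D.L.zero_mem))
  exact ⟨K, ⟨fun x hx => (hK hx).2, ho, hd, hc⟩, fun k hk => (hK hk).1⟩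

end Lattice

section Rep

variable {F R W V : Type*} [Field F] [Field R] [AddCommGroup W] [Module F W]
  [AddCommGroup V] [Module R V] {ψ : AddChar F R} {B : LinearMap.BilinForm F W}
  {ρ : Representation R (Heisenberg B) V}

theorem _root_.HasCentralChar.apply_eq (hc : HasCentralChar ψ ρ) (w : W) (t s : F) (v : V) :
    ρ ⟨w, t⟩ v = ψ (t - s) • ρ ⟨w, s⟩ v := by
  rw [← hc, ← Module.End.mul_apply, ← map_mul]
  congr 2
  ext <;> simp

theorem _root_.HasCentralChar.apply_comm [NeZero (2 : F)] (hc : HasCentralChar ψ ρ) (hB : B.IsAlt)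
    (x y : Heisenberg B) (v : V) :
    ρ x (ρ y v) = ψ (B x.vec y.vec) • ρ y (ρ x v) := by
  rw [← hc, ← Module.End.mul_apply, ← Module.End.mul_apply, ← Module.End.mul_apply, ← map_mul,
    ← map_mul, ← map_mul]
  congr 2
  have := isAlt_swap hB y.vec x.vec
  ext
  · simp [add_comm]
  · simp only [Heisenberg.cen_mul, Heisenberg.vec_mul, zero_add, this, map_zero, LinearMap.zero_apply]
    field_simp
    ring

variable [TopologicalSpace F] [TopologicalSpace W] (D : LagrangianDatum ψ B)

theorem apply_lift_add (hc : HasCentralChar ψ ρ) {l l' : W} (hl : l ∈ D.L) (hl' : l' ∈ D.L)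
    (v : V) : ρ (D.lift (l + l')) v = ρ (D.lift l) (ρ (D.lift l') v) := by
  rw [← Module.End.mul_apply, ← map_mul]
  have h := (addChar_eq_iff _ _ _).mp (D.q_add l hl l' hl')
  have e := hc.apply_eq (l + l') (D.q (l + l')) (D.q l + D.q l' + B l l' / 2) v
  rw [h, one_smul] at e
  exact e

variable (ρ) in
/-- The vectors fixed by the lattice. -/
def fixed : Submodule R V where
  carrier := {v | ∀ l ∈ D.L, ρ (D.lift l) v = v}
  add_mem' := by
    intro v w hv hw l hl
    rw [map_add, hv l hl, hw l hl]
  zero_mem' := by simp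
  smul_mem' := by
    intro c v hv l hl
    rw [map_smul, hv l hl]

variable (ρ) in
/-- The span of the vectors `l • u - u` for `l` in the lattice, that is, the kernel of the
projection to the coinvariants of the lattice. -/
def augmentation : Submodule R V :=
  Submodule.span R {v | ∃ l ∈ D.L, ∃ u, v = ρ (D.lift l) u - u}

variable {D}

theorem sub_mem_augmentation {l : W} (hl : l ∈ D.L) (u : V) :
    ρ (D.lift l) u - u ∈ D.augmentation ρ := Submodule.subset_span ⟨l, hl, u, rfl⟩

theorem apply_lift_add_of_fixed (hc : HasCentralChar ψ ρ) {K : AddSubgroup W} {v : V}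
    (hv : ∀ k ∈ K, ρ (D.lift k) v = v) :
    ∀ l ∈ D.L, ∀ k ∈ K, k ∈ D.L → ρ (D.lift (l + k)) v = ρ (D.lift l) v := by
  intro l hl k hk hk'
  rw [D.apply_lift_add hc hl hk', hv k hk]

/-- Averaging over the lattice produces fixed vectors. -/
theorem sum_mem_fixed (hc : HasCentralChar ψ ρ) {K : AddSubgroup W}
    [Finite (D.L ⧸ K.addSubgroupOf D.L)] {v : V} (hv : ∀ k ∈ K, ρ (D.lift k) v = v) :
    ∑ l ∈ cosetReps K D.L, ρ (D.lift l) v ∈ D.fixed ρ := by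
  intro l hl
  rw [map_sum, ← sum_cosetReps_add_left (f := fun l => ρ (D.lift l) v) (apply_lift_add_of_fixed hc hv) hl]
  exact Finset.sum_congr rfl fun t ht => (D.apply_lift_add hc hl (mem_of_mem_cosetReps ht) v).symm

theorem card_cosetReps_ne_zero (hB : B.IsAlt) {K : AddSubgroup W} (hK : D.IsSmall K)
    [Finite (D.L ⧸ K.addSubgroupOf D.L)] : ((cosetReps K D.L).card : R) ≠ 0 := by
  refine natCast_card_cosetReps_ne_zero
    (fun w : charPerp ψ B K => ψ.compAddMonoidHom (B w).toAddMonoidHom)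
    (fun p hp w => w.2 p hp) fun a _ h => ?_
  rw [← hK.charPerp_charPerp]
  intro w hw
  rw [isAlt_swap hB, AddChar.map_neg_eq_inv, inv_eq_one]
  exact h ⟨w, hw⟩

theorem card_cosetReps_charPerp_ne_zero (hB : B.IsAlt) {K : AddSubgroup W}
    [Finite (charPerp ψ B K ⧸ D.L.addSubgroupOf (charPerp ψ B K))] :
    ((cosetReps D.L (charPerp ψ B K)).card : R) ≠ 0 := by
  refine natCast_card_cosetReps_ne_zero
    (fun w : D.L => ψ.compAddMonoidHom (B w).toAddMonoidHom)
    (fun p hp w => D.apply_eq_one w.2 hp) fun a _ h => ?_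
  rw [← D.charPerp_eq]
  intro w hw
  rw [isAlt_swap hB, AddChar.map_neg_eq_inv, inv_eq_one]
  exact h ⟨w, hw⟩

/-- Orthogonality of characters on `K^⊥ / L`. -/
theorem sum_charPerp_eq_zero (hB : B.IsAlt) {K : AddSubgroup W} (hK : D.IsSmall K)
    [Finite (charPerp ψ B K ⧸ D.L.addSubgroupOf (charPerp ψ B K))] {l : W} (hl : l ∈ D.L)
    (hlK : l ∉ K) : ∑ w ∈ cosetReps D.L (charPerp ψ B K), ψ (B w l) = 0 := by
  obtain ⟨w₀, hw₀, hne⟩ : ∃ w₀ ∈ charPerp ψ B K, ψ (B l w₀) ≠ 1 := by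
    rw [← hK.charPerp_charPerp] at hlK
    simpa [mem_charPerp] using hlK
  have hne' : ψ (B w₀ l) ≠ 1 := by
    rwa [isAlt_swap hB, AddChar.map_neg_eq_inv, Ne, inv_eq_one]
  have h := sum_cosetReps_add_left (P := D.L) (Q := charPerp ψ B K) (f := fun w => ψ (B w l))
    (fun a _ p hp _ => by
      simp only [map_add, LinearMap.add_apply, AddChar.map_add_eq_mul, D.apply_eq_one hp hl,
        mul_one]) hw₀
  simp only [map_add, LinearMap.add_apply, AddChar.map_add_eq_mul, ← Finset.mul_sum] at h
  by_contra hne0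
  exact hne' (mul_right_cancel₀ hne0 (h.trans (one_mul _).symm))

section ModuleTopology

variable [IsTopologicalRing F] [IsModuleTopology F W]

omit [IsTopologicalRing F] in
theorem exists_isSmall_fixing (hs : IsSmoothRep ρ) (v : V) :
    ∃ K, D.IsSmall K ∧ ∀ k ∈ K, ρ (D.lift k) v = v :=
  D.exists_isSmall ((hs v).mem_nhds (by simp))

/-- The lattice acts through finite groups of invertible order, so that a fixed vector that
vanishes in the coinvariants is zero. -/
theorem fixed_inf_augmentation (hc : HasCentralChar ψ ρ) (hB : B.IsAlt) (hs : IsSmoothRep ρ)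
    {v : V} (hv : v ∈ D.fixed ρ) (hv' : v ∈ D.augmentation ρ) : v = 0 := by
  have key : ∀ z ∈ D.augmentation ρ, ∃ N ∈ nhds (1 : Heisenberg B), ∀ K, (hK : D.IsSmall K) →
      (∀ k ∈ K, D.lift k ∈ N) → letI := hK.finite_quotient
        ∑ l ∈ cosetReps K D.L, ρ (D.lift l) z = 0 := by
    intro z hz
    induction hz using Submodule.span_induction with
    | mem z hz =>
      obtain ⟨l₀, hl₀, u, rfl⟩ := hz
      refine ⟨_, (hs u).mem_nhds (by simp), fun K hK hKu => ?_⟩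
      have := hK.finite_quotient
      have h := sum_cosetReps_add_left (f := fun l => ρ (D.lift l) u)
        (apply_lift_add_of_fixed (D := D) hc hKu) hl₀
      simp only [map_sub, Finset.sum_sub_distrib]
      rw [sub_eq_zero, ← h]
      refine Finset.sum_congr rfl fun l hl => ?_
      rw [add_comm, D.apply_lift_add hc (mem_of_mem_cosetReps hl) hl₀]
    | zero => exact ⟨Set.univ, Filter.univ_mem, fun K hK _ => by simp⟩
    | add x y _ _ hx hy =>
      obtain ⟨N₁, hN₁, h₁⟩ := hx
      obtain ⟨N₂, hN₂, h₂⟩ := hy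
      refine ⟨_, Filter.inter_mem hN₁ hN₂, fun K hK h => ?_⟩
      simp only [map_add, Finset.sum_add_distrib]
      rw [h₁ K hK fun k hk => (h k hk).1, h₂ K hK fun k hk => (h k hk).2, add_zero]
    | smul c x _ hx =>
      obtain ⟨N, hN, h⟩ := hx
      refine ⟨N, hN, fun K hK h' => ?_⟩
      simp only [map_smul, ← Finset.smul_sum]
      rw [h K hK h', smul_zero]
  obtain ⟨N, hN, h⟩ := key v hv'
  obtain ⟨K, hK, hKN⟩ := D.exists_isSmall hN
  have := hK.finite_quotient
  have h0 := h K hK hKN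
  rw [Finset.sum_congr rfl fun l hl => hv l (mem_of_mem_cosetReps hl), Finset.sum_const,
    ← Nat.cast_smul_eq_nsmul R] at h0
  exact (smul_eq_zero.mp h0).resolve_left (card_cosetReps_ne_zero hB hK)

end ModuleTopology

variable [NeZero (2 : F)]

/-- Fourier inversion on the lattice: a vector fixed by a small subgroup `K` is a sum of
translates, by finitely many elements that depend only on `K`, of vectors fixed by the lattice. -/
theorem exists_eq_sum (hc : HasCentralChar ψ ρ) (hB : B.IsAlt) {K : AddSubgroup W}
    (hK : D.IsSmall K) [Finite (D.L ⧸ K.addSubgroupOf D.L)]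
    [Finite (charPerp ψ B K ⧸ D.L.addSubgroupOf (charPerp ψ B K))]
    {v : V} (hv : ∀ k ∈ K, ρ (D.lift k) v = v) :
    ∃ u : W → V, (∀ w ∈ cosetReps D.L (charPerp ψ B K), u w ∈ D.fixed ρ ∧
        ∀ N : Subrepresentation ρ, v ∈ N → u w ∈ N) ∧
      v = ∑ w ∈ cosetReps D.L (charPerp ψ B K), ρ ⟨w, 0⟩ (u w) := by
  set T := cosetReps D.L (charPerp ψ B K)
  have hT0 : (T.card : R) ≠ 0 := card_cosetReps_charPerp_ne_zero hB
  refine ⟨fun w => (T.card : R)⁻¹ • ∑ l ∈ cosetReps K D.L, ρ (D.lift l) (ρ ⟨-w, 0⟩ v),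
    fun w hw => ⟨?_, fun N hN => ?_⟩, ?_⟩
  · refine Submodule.smul_mem _ _ (sum_mem_fixed hc fun k hk => ?_)
    have h1 : ψ (B k (-w)) = 1 := by
      rw [map_neg, isAlt_swap hB k w, neg_neg]
      exact mem_of_mem_cosetReps hw k hk
    rw [hc.apply_comm hB, hv k hk]
    change ψ (B k (-w)) • _ = _
    rw [h1, one_smul]
  · exact N.toSubmodule.smul_mem _ (N.toSubmodule.sum_mem fun l _ =>
      N.apply_mem_toSubmodule _ (N.apply_mem_toSubmodule _ hN))
  · have key : ∀ w l, ρ ⟨w, 0⟩ (ρ (D.lift l) (ρ ⟨-w, 0⟩ v)) = ψ (B w l) • ρ (D.lift l) v := by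
      intro w l
      have e : (⟨w, 0⟩ * ⟨-w, 0⟩ : Heisenberg B) = 1 := by
        ext <;> simp [hB.self_eq_zero]
      rw [hc.apply_comm hB, ← Module.End.mul_apply (ρ ⟨w, 0⟩), ← map_mul, e, map_one]
      rfl
    simp only [map_smul, map_sum, key, ← Finset.smul_sum]
    rw [Finset.sum_comm]
    simp only [← Finset.sum_smul]
    rw [sum_cosetReps_of_eq_zero (f := fun l => (∑ w ∈ T, ψ (B w l)) • ρ (D.lift l) v)]
    · have h0 : ρ (D.lift 0) v = v := hv 0 K.zero_mem
      simp [h0, smul_smul, hT0]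
    · intro l hl k hk hk'
      rw [apply_lift_add_of_fixed hc hv l hl k hk hk']
      congr 1
      refine Finset.sum_congr rfl fun w hw => ?_
      rw [map_add, AddChar.map_add_eq_mul, mem_of_mem_cosetReps hw k hk, mul_one]
    · intro l hl hlK
      rw [sum_charPerp_eq_zero hB hK hl hlK, zero_smul]

variable [IsTopologicalRing F] [IsModuleTopology F W]

/-- A nonzero subrepresentation contains a nonzero fixed vector. -/
theorem exists_mem_fixed (hc : HasCentralChar ψ ρ) (hB : B.IsAlt) (hs : IsSmoothRep ρ)
    {N : Subrepresentation ρ} (hN : N ≠ ⊥) : ∃ v ∈ N, v ∈ D.fixed ρ ∧ v ≠ 0 := by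
  by_contra! h
  refine hN (eq_bot_iff.mpr fun v hv => ?_)
  obtain ⟨K, hK, hKv⟩ := D.exists_isSmall_fixing hs v
  have := hK.finite_quotient
  have := hK.finite_quotient_charPerp
  obtain ⟨u, hu, huv⟩ := exists_eq_sum hc hB hK hKv
  have : v = 0 := by
    rw [huv]
    exact Finset.sum_eq_zero fun w hw => by
      rw [h (u w) ((hu w hw).2 N hv) (hu w hw).1, map_zero]
  rw [this]
  exact (⊥ : Subrepresentation ρ).toSubmodule.zero_mem

/-- A smooth representation with central character `ψ` is generated by its fixed vectors. -/
theorem eq_top_of_fixed_le (hc : HasCentralChar ψ ρ) (hB : B.IsAlt) (hs : IsSmoothRep ρ)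
    {N : Subrepresentation ρ} (hN : D.fixed ρ ≤ N.toSubmodule) : N = ⊤ := by
  refine eq_top_iff.mpr fun v _ => ?_
  obtain ⟨K, hK, hKv⟩ := D.exists_isSmall_fixing hs v
  have := hK.finite_quotient
  have := hK.finite_quotient_charPerp
  obtain ⟨u, hu, huv⟩ := exists_eq_sum hc hB hK hKv
  rw [huv]
  exact N.toSubmodule.sum_mem fun w hw => N.apply_mem_toSubmodule _ (hN (hu w hw).1)

omit [IsTopologicalRing F] [IsModuleTopology F W] in
/-- A translate of a fixed vector `v` by `w` is an eigenvector of the lattice for the character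
`ψ (B · w)`, which is trivial only if `w` lies in the lattice. -/
theorem cyclicSubrep_le_sup (hc : HasCentralChar ψ ρ) (hB : B.IsAlt) {v : V}
    (hv : v ∈ D.fixed ρ) :
    (cyclicSubrep ρ v).toSubmodule ≤ Submodule.span R {v} ⊔ D.augmentation ρ := by
  refine Submodule.span_le.mpr ?_
  rintro _ ⟨⟨w, t⟩, rfl⟩
  by_cases hw : w ∈ D.L
  · have e : ρ ⟨w, t⟩ v = ψ (t - D.q w) • v := by
      rw [hc.apply_eq w t (D.q w)]
      exact congrArg _ (hv w hw)
    change ρ ⟨w, t⟩ v ∈ _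
    rw [e]
    exact Submodule.mem_sup_left (Submodule.smul_mem _ _ (Submodule.mem_span_singleton_self v))
  · obtain ⟨l, hl, hne⟩ : ∃ l ∈ D.L, ψ (B w l) ≠ 1 := by
      rw [← D.charPerp_eq] at hw
      simpa [mem_charPerp] using hw
    have hne' : ψ (B l w) - 1 ≠ 0 := by
      rwa [isAlt_swap hB, AddChar.map_neg_eq_inv, sub_ne_zero, Ne, inv_eq_one]
    have h := sub_mem_augmentation (ρ := ρ) hl (ρ ⟨w, t⟩ v)
    rw [hc.apply_comm hB, hv l hl] at h
    change ψ (B l w) • ρ ⟨w, t⟩ v - ρ ⟨w, t⟩ v ∈ _ at h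
    rw [show ψ (B l w) • ρ ⟨w, t⟩ v - ρ ⟨w, t⟩ v = (ψ (B l w) - 1) • ρ ⟨w, t⟩ v by
      rw [sub_smul, one_smul]] at h
    exact Submodule.mem_sup_right ((Submodule.smul_mem_iff _ hne').mp h)

/-- The fixed vectors in the representation generated by a fixed vector form a line. -/
theorem mem_span_of_mem_cyclicSubrep (hc : HasCentralChar ψ ρ) (hB : B.IsAlt)
    (hs : IsSmoothRep ρ) {u v : V} (hv : v ∈ D.fixed ρ) (hu : u ∈ D.fixed ρ)
    (huv : u ∈ cyclicSubrep ρ v) : u ∈ Submodule.span R {v} := by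
  obtain ⟨x, hx, z, hz, rfl⟩ := Submodule.mem_sup.mp (cyclicSubrep_le_sup hc hB hv huv)
  have hx' : x ∈ D.fixed ρ := (Submodule.span_singleton_le_iff_mem v _).mpr hv hx
  have : z = 0 := fixed_inf_augmentation hc hB hs (by simpa using sub_mem hu hx') hz
  rwa [this, add_zero]

theorem isAtom_cyclicSubrep (hc : HasCentralChar ψ ρ) (hB : B.IsAlt) (hs : IsSmoothRep ρ)
    {v : V} (hv : v ∈ D.fixed ρ) (hv0 : v ≠ 0) : IsAtom (cyclicSubrep ρ v) := by
  refine ⟨fun h => hv0 ?_, fun N hN => ?_⟩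
  · have := mem_cyclicSubrep ρ v
    rw [h] at this
    exact (Submodule.mem_bot R).mp this
  · by_contra hN0
    obtain ⟨u, huN, hu, hu0⟩ := exists_mem_fixed hc hB hs (D := D) hN0
    obtain ⟨c, rfl⟩ := Submodule.mem_span_singleton.mp
      (mem_span_of_mem_cyclicSubrep hc hB hs hv hu (hN.le huN))
    have hc0 : c ≠ 0 := fun h => hu0 (by rw [h, zero_smul])
    have hvN : v ∈ N := (Submodule.smul_mem_iff N.toSubmodule hc0).mp huN
    exact hN.not_ge (cyclicSubrep_le hvN)

/-- The irreducibility criterion used for extensions of scalars and tensor products. -/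
theorem isIrreducible_of_cyclicSubrep_eq_top (hc : HasCentralChar ψ ρ) (hB : B.IsAlt)
    (hs : IsSmoothRep ρ) {v : V} (hv : v ∈ D.fixed ρ) (hv0 : v ≠ 0)
    (h : cyclicSubrep ρ v = ⊤) : ρ.IsIrreducible := by
  rw [Representation.IsIrreducible, isSimpleOrder_iff_isAtom_top, ← h]
  exact isAtom_cyclicSubrep hc hB hs hv hv0

/-- The irreducibility criterion used for the contragredient. -/
theorem isIrreducible_of_fixed_le (hc : HasCentralChar ψ ρ) (hB : B.IsAlt)
    (hs : IsSmoothRep ρ) {v : V} (hv : v ∈ D.fixed ρ) (hv0 : v ≠ 0)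
    (h : D.fixed ρ ≤ Submodule.span R {v}) : ρ.IsIrreducible :=
  isIrreducible_of_cyclicSubrep_eq_top hc hB hs hv hv0 <| eq_top_of_fixed_le hc hB hs <|
    h.trans ((Submodule.span_singleton_le_iff_mem v _).mpr (mem_cyclicSubrep ρ v))

/-- Every Heisenberg representation is generated by a nonzero fixed vector. -/
theorem exists_generator (h : IsHeisenbergRep ψ ρ) (hB : B.IsAlt) (D : LagrangianDatum ψ B) :
    ∃ v ∈ D.fixed ρ, v ≠ 0 ∧ cyclicSubrep ρ v = ⊤ := by
  have := h.irreducible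
  obtain ⟨v, -, hv, hv0⟩ := exists_mem_fixed h.central hB h.smooth (D := D)
    (top_ne_bot (α := Subrepresentation ρ))
  exact ⟨v, hv, hv0, (eq_bot_or_eq_top (cyclicSubrep ρ v)).resolve_left
    (isAtom_cyclicSubrep h.central hB h.smooth hv hv0).ne_bot⟩

theorem isSemisimpleRepresentation (D : LagrangianDatum ψ B) (hc : HasCentralChar ψ ρ)
    (hB : B.IsAlt) (hs : IsSmoothRep ρ) : ρ.IsSemisimpleRepresentation := by
  rw [Representation.isSemisimpleRepresentation_iff_isSemisimpleModule_asModule]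
  set Φ := Subrepresentation.subrepresentationSubmoduleOrderIso (ρ := ρ)
  refine IsSemisimpleModule.of_sSup_simples_eq_top ?_
  set S := sSup {m : Submodule (MonoidAlgebra R (Heisenberg B)) ρ.asModule |
    IsSimpleModule (MonoidAlgebra R (Heisenberg B)) m}
  have h : Φ.symm S = ⊤ := by
    refine eq_top_of_fixed_le (D := D) hc hB hs fun v hv => ?_
    by_cases hv0 : v = 0
    · rw [hv0]; exact (Φ.symm S).toSubmodule.zero_mem
    have hat := (Φ.isAtom_iff _).mpr (isAtom_cyclicSubrep hc hB hs hv hv0)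
    have hle : Φ (cyclicSubrep ρ v) ≤ S := le_sSup (isSimpleModule_iff_isAtom.mpr hat)
    exact (Φ.le_symm_apply.mpr hle) (mem_cyclicSubrep ρ v)
  rw [← Φ.apply_symm_apply S, h, map_top]

end Rep

end LagrangianDatum

/-! ### Uniqueness of the Heisenberg representation -/

section

variable {R G V V' : Type*} [Field R] [Group G] [AddCommGroup V] [Module R V]
  [AddCommGroup V'] [Module R V']

/-- An intertwining map restricts to a bijection from a simple cyclic subrepresentation to the
target, if it sends the generator to a nonzero generator. -/
theorem bijective_domRestrict_cyclicSubrep {σ : Representation R G V} {τ : Representation R G V'}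
    (f : V →ₗ[R] V') (hf : ∀ g v, f (σ g v) = τ g (f v)) {z : V} (hz : IsAtom (cyclicSubrep σ z))
    (h0 : f z ≠ 0) (hg : cyclicSubrep τ (f z) = ⊤) :
    Function.Bijective (f.domRestrict (cyclicSubrep σ z).toSubmodule) := by
  let k : Subrepresentation σ :=
    ⟨LinearMap.ker f, fun g v hv => by
      rw [LinearMap.mem_ker] at hv ⊢
      rw [hf, hv, map_zero]⟩
  let m : Subrepresentation τ :=
    ⟨(cyclicSubrep σ z).toSubmodule.map f, fun g v hv => by
      obtain ⟨x, hx, rfl⟩ := hv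
      exact ⟨σ g x, (cyclicSubrep σ z).apply_mem_toSubmodule g hx, hf g x⟩⟩
  constructor
  · rw [← LinearMap.ker_eq_bot, eq_bot_iff]
    intro x hx
    have hlt : cyclicSubrep σ z ⊓ k < cyclicSubrep σ z :=
      lt_of_le_of_ne inf_le_left fun h => h0 (inf_eq_left.mp h (mem_cyclicSubrep σ z))
    have hx' : (x : V) ∈ cyclicSubrep σ z ⊓ k := ⟨x.2, hx⟩
    rw [hz.2 _ hlt] at hx'
    exact (Submodule.mem_bot R).mpr (Subtype.ext ((Submodule.mem_bot R).mp hx'))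
  · have hm : m = ⊤ := by
      rw [eq_top_iff, ← hg]
      exact cyclicSubrep_le (N := m) ⟨z, mem_cyclicSubrep σ z, rfl⟩
    intro y
    have hy : y ∈ m := by rw [hm]; trivial
    obtain ⟨x, hx, rfl⟩ := hy
    exact ⟨⟨x, hx⟩, rfl⟩

end

section

variable {F R W V V' : Type*} [Field F] [Field R] [AddCommGroup W] [Module F W]
  [TopologicalSpace F] [IsTopologicalRing F] [TopologicalSpace W] [IsModuleTopology F W]
  [NeZero (2 : F)]
  [AddCommGroup V] [Module R V] [AddCommGroup V'] [Module R V']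
  {ψ : AddChar F R} {B : LinearMap.BilinForm F W}
  {ρ : Representation R (Heisenberg B) V} {ρ' : Representation R (Heisenberg B) V'}

open LagrangianDatum

/-- Two Heisenberg representations for the same character are isomorphic: generators fixed by the
lattice form a pair that generates the graph of an isomorphism. -/
theorem IsHeisenbergRep.nonempty_equiv (D : LagrangianDatum ψ B) (hB : B.IsAlt)
    (h : IsHeisenbergRep ψ ρ) (h' : IsHeisenbergRep ψ ρ') : Nonempty (ρ.Equiv ρ') := by
  obtain ⟨v, hv, hv0, hg⟩ := exists_generator h hB D
  obtain ⟨v', hv', hv0', hg'⟩ := exists_generator h' hB D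
  have hs : IsSmoothRep (ρ.prod ρ') := fun u => by
    convert! (h.smooth u.1).inter (h'.smooth u.2) using 1
    ext g
    simp [Prod.ext_iff]
  have hc : HasCentralChar ψ (ρ.prod ρ') := fun t u =>
    Prod.ext (h.central t u.1) (h'.central t u.2)
  have hz := isAtom_cyclicSubrep (D := D) (v := (v, v')) hc hB hs
    (fun l hl => Prod.ext (hv l hl) (hv' l hl)) fun h0 => hv0 (congrArg Prod.fst h0)
  let Z := cyclicSubrep (ρ.prod ρ') (v, v')
  let e := LinearEquiv.ofBijective _ (bijective_domRestrict_cyclicSubrep (τ := ρ)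
    (LinearMap.fst R V V') (fun _ _ => rfl) hz hv0 hg)
  let e' := LinearEquiv.ofBijective _ (bijective_domRestrict_cyclicSubrep (τ := ρ')
    (LinearMap.snd R V V') (fun _ _ => rfl) hz hv0' hg')
  refine ⟨Representation.Equiv.mk (e.symm.trans e') fun g => LinearMap.ext fun x => ?_⟩
  obtain ⟨y, rfl⟩ := e.surjective x
  have hy : e (Z.toRepresentation g y) = ρ g (e y) := rfl
  have hy' : e' (Z.toRepresentation g y) = ρ' g (e' y) := rfl
  change e' (e.symm (ρ g (e y))) = ρ' g (e' (e.symm (e y)))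
  rw [← hy, e.symm_apply_apply, e.symm_apply_apply, hy']

/-! ### Admissibility and Schur's lemma -/

theorem IsHeisenbergRep.fixed_le (D : LagrangianDatum ψ B) (hB : B.IsAlt)
    (h : IsHeisenbergRep ψ ρ) {v : V} (hv : v ∈ D.fixed ρ) (hg : cyclicSubrep ρ v = ⊤) :
    D.fixed ρ ≤ Submodule.span R {v} := fun u hu =>
  mem_span_of_mem_cyclicSubrep h.central hB h.smooth hv hu (by rw [hg]; trivial)

theorem IsHeisenbergRep.isAdmissibleRep (D : LagrangianDatum ψ B) (hB : B.IsAlt)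
    (h : IsHeisenbergRep ψ ρ) : IsAdmissibleRep ρ := by
  refine ⟨h.smooth, fun U hU _ => ?_⟩
  obtain ⟨v, hv, hv0, hg⟩ := exists_generator h hB D
  obtain ⟨K, hK, hKU⟩ := D.exists_isSmall (hU.mem_nhds U.one_mem)
  have := hK.finite_quotient
  have := hK.finite_quotient_charPerp
  let T := cosetReps D.L (charPerp ψ B K)
  have : FiniteDimensional R (Submodule.span R ((fun w => ρ ⟨w, 0⟩ v) '' (T : Set W))) :=
    FiniteDimensional.span_of_finite R (T.finite_toSet.image _)
  refine Submodule.finiteDimensional_of_le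
    (S₂ := Submodule.span R ((fun w => ρ ⟨w, 0⟩ v) '' (T : Set W))) fun u hu => ?_
  obtain ⟨x, hx, rfl⟩ := exists_eq_sum h.central hB hK (v := u)
    fun k hk => hu ⟨D.lift k, hKU k hk⟩
  refine Submodule.sum_mem _ fun w hw => ?_
  obtain ⟨c, hc⟩ := Submodule.mem_span_singleton.mp (h.fixed_le D hB hv hg (hx w hw).1)
  rw [← hc, map_smul]
  exact Submodule.smul_mem _ _ (Submodule.subset_span ⟨w, hw, rfl⟩)

theorem IsHeisenbergRep.satisfiesSchur (D : LagrangianDatum ψ B) (hB : B.IsAlt)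
    (h : IsHeisenbergRep ψ ρ) : SatisfiesSchur ρ := by
  obtain ⟨v, hv, hv0, hg⟩ := exists_generator h hB D
  refine ⟨fun a b hab => ?_, fun φ => ?_⟩
  · have : a • v = b • v := congrArg (fun φ : ρ.IntertwiningMap ρ => φ v) hab
    exact smul_left_injective R hv0 this
  · have hφ : φ v ∈ D.fixed ρ := fun l hl => by rw [← φ.isIntertwining, hv l hl]
    obtain ⟨c, hc⟩ := Submodule.mem_span_singleton.mp (h.fixed_le D hB hv hg hφ)
    let N : Subrepresentation ρ :=
      ⟨LinearMap.ker (φ.toLinearMap - c • LinearMap.id), fun g u hu => by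
        rw [LinearMap.mem_ker] at hu ⊢
        have hu' : φ u - c • u = 0 := hu
        change φ (ρ g u) - c • ρ g u = 0
        rw [φ.isIntertwining, ← map_smul, ← map_sub, hu', map_zero]⟩
    have hN : N = ⊤ := by
      rw [eq_top_iff, ← hg]
      exact cyclicSubrep_le (N := N) (sub_eq_zero.mpr hc.symm)
    refine ⟨c, Representation.IntertwiningMap.ext (LinearMap.ext fun u => ?_)⟩
    have hu : u ∈ N := by rw [hN]; trivial
    exact (sub_eq_zero.mp hu).symm

/-! ### Smoothness criteria and pure tensors -/

/-- Smoothness may be checked on a spanning set. -/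
theorem isSmoothRep_of_span {G X : Type*} [Group G] [TopologicalSpace G] [IsTopologicalGroup G]
    [AddCommGroup X] [Module R X] {σ : Representation R G X} {s : Set X}
    (hs : Submodule.span R s = ⊤) (h : ∀ x ∈ s, IsOpen {g | σ g x = x}) : IsSmoothRep σ := by
  have : (⊤ : Submodule R X) ≤ (smoothVectors σ).toSubmodule := by
    rw [← hs]
    exact Submodule.span_le.mpr h
  exact fun v => this trivial

theorem isOpen_fixing_of_mem_nhds {G X : Type*} [Group G] [TopologicalSpace G]
    [IsTopologicalGroup G] [AddCommGroup X] [Module R X] {σ : Representation R G X} {x : X}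
    (h : {g | σ g x = x} ∈ nhds 1) : IsOpen {g | σ g x = x} :=
  (repStabilizer σ x).isOpen_of_mem_nhds h

theorem tmul_ne_zero_of_ne_zero {X Y : Type*} [AddCommGroup X] [Module R X] [AddCommGroup Y]
    [Module R Y] {x : X} {y : Y} (hx : x ≠ 0) (hy : y ≠ 0) : x ⊗ₜ[R] y ≠ 0 := by
  obtain ⟨f, hf, -⟩ := Submodule.exists_le_ker_of_notMem (K := R) (p := ⊥) (by simpa using hx)
  obtain ⟨g, hg, -⟩ := Submodule.exists_le_ker_of_notMem (K := R) (p := ⊥) (by simpa using hy)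
  intro h
  have := congrArg (TensorProduct.lid R R ∘ TensorProduct.map f g) h
  simp [hf, hg] at this

/-! ### Extension of scalars -/

theorem IsHeisenbergRep.repBaseChange [FiniteDimensional F W] (D : LagrangianDatum ψ B)
    (hB : B.IsAlt) (h : IsHeisenbergRep ψ ρ) (R' : Type*) [Field R'] [Algebra R R'] :
    (repBaseChange R' ρ).IsIrreducible := by
  obtain ⟨v, hv, hv0, hg⟩ := exists_generator h hB D
  let ψ' : AddChar F R' := (algebraMap R R' : R →* R').compAddChar ψ
  have hψ' : ∀ t, ψ' t = algebraMap R R' (ψ t) := fun _ => rfl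
  let D' : LagrangianDatum ψ' B := D.ofKer fun t => by
    rw [hψ', ← map_one (algebraMap R R'), (algebraMap R R').injective.eq_iff]
  have tmul : ∀ g (a : R') u, _root_.repBaseChange R' ρ g (a ⊗ₜ[R] u) = a ⊗ₜ[R] ρ g u :=
    fun _ _ _ => rfl
  have span : Submodule.span R' {x : R' ⊗[R] V | ∃ u, x = 1 ⊗ₜ[R] u} = ⊤ := by
    refine eq_top_iff.mpr fun x _ => ?_
    induction x using TensorProduct.induction_on with
    | zero => exact zero_mem _
    | tmul a u =>
      have : a ⊗ₜ[R] u = a • (1 ⊗ₜ[R] u : R' ⊗[R] V) := by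
        rw [TensorProduct.smul_tmul', smul_eq_mul, mul_one]
      rw [this]
      exact Submodule.smul_mem _ _ (Submodule.subset_span ⟨u, rfl⟩)
    | add x y hx hy => exact add_mem (hx trivial) (hy trivial)
  have hs : IsSmoothRep (_root_.repBaseChange R' ρ) := isSmoothRep_of_span span <| by
    rintro _ ⟨u, rfl⟩
    refine isOpen_fixing_of_mem_nhds
      (Filter.mem_of_superset ((h.smooth u).mem_nhds (by simp)) fun g hg' => ?_)
    change _root_.repBaseChange R' ρ g (1 ⊗ₜ[R] u) = 1 ⊗ₜ[R] u
    rw [tmul, show ρ g u = u from hg']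
  have hc : HasCentralChar ψ' (_root_.repBaseChange R' ρ) := fun t x => by
    induction x using TensorProduct.induction_on with
    | zero => simp
    | tmul a u => rw [tmul, h.central, hψ', TensorProduct.tmul_smul, algebraMap_smul]
    | add x y hx hy => rw [map_add, hx, hy, smul_add]
  refine isIrreducible_of_cyclicSubrep_eq_top (D := D') (v := 1 ⊗ₜ[R] v) hc hB hs
    (fun l hl => ?_) (tmul_ne_zero_of_ne_zero one_ne_zero hv0) ?_
  · exact congrArg (fun u => (1 : R') ⊗ₜ[R] u) (hv l hl)
  · refine eq_top_iff.mpr ?_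
    change (⊤ : Submodule R' (R' ⊗[R] V)) ≤ _
    rw [← span]
    refine Submodule.span_le.mpr ?_
    rintro _ ⟨u, rfl⟩
    have hu : u ∈ cyclicSubrep ρ v := by rw [hg]; trivial
    change (1 : R') ⊗ₜ[R] u ∈ (cyclicSubrep (_root_.repBaseChange R' ρ) (1 ⊗ₜ[R] v)).toSubmodule
    refine Submodule.span_induction (p := fun u _ => (1 : R') ⊗ₜ[R] u ∈
      (cyclicSubrep (_root_.repBaseChange R' ρ) (1 ⊗ₜ[R] v)).toSubmodule) ?_ ?_ ?_ ?_ hu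
    · rintro _ ⟨g, rfl⟩
      exact apply_mem_cyclicSubrep _ g _
    · rw [TensorProduct.tmul_zero]
      exact zero_mem _
    · intro x y _ _ hx hy
      rw [TensorProduct.tmul_add]
      exact add_mem hx hy
    · intro c x _ hx
      rw [TensorProduct.tmul_smul, ← algebraMap_smul R' c]
      exact Submodule.smul_mem _ _ hx

/-! ### The contragredient -/

theorem isSmoothRep_contragredient {G X : Type*} [Group G] [TopologicalSpace G]
    [IsTopologicalGroup G] [AddCommGroup X] [Module R X] (σ : Representation R G X) :
    IsSmoothRep (V := (smoothVectors σ.dual).toSubmodule) (contragredient σ) := by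
  rintro ⟨f, hf⟩
  convert! (show IsOpen {g | σ.dual g f = f} from hf) using 1
  ext g
  exact Subtype.ext_iff

omit [IsTopologicalRing F] [TopologicalSpace W] [IsModuleTopology F W] [NeZero (2 : F)]
  [TopologicalSpace F] in
theorem HasCentralChar.dual (h : HasCentralChar ψ ρ) : HasCentralChar ψ⁻¹ ρ.dual := by
  intro t f
  ext u
  have e : (⟨0, t⟩ : Heisenberg B)⁻¹ = ⟨0, -t⟩ := by ext <;> simp
  change f (ρ (⟨0, t⟩ : Heisenberg B)⁻¹ u) = ψ⁻¹ t • f u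
  rw [e, h, map_smul, AddChar.inv_apply]

/-- The contragredient is the Heisenberg representation of the inverse character: the
lattice-invariant functionals form a line, spanned by one that is nonzero on the fixed vector and
vanishes on the augmentation. -/
theorem IsHeisenbergRep.contragredient [FiniteDimensional F W] (hψ : IsSmoothAddChar ψ)
    (D : LagrangianDatum ψ B) (hB : B.IsAlt) (h : IsHeisenbergRep ψ ρ) :
    IsHeisenbergRep (V := (smoothVectors ρ.dual).toSubmodule) ψ⁻¹ (_root_.contragredient ρ) := by
  obtain ⟨v, hv, hv0, hg⟩ := exists_generator h hB D
  have hs := isSmoothRep_contragredient ρ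
  have hc : HasCentralChar (V := (smoothVectors ρ.dual).toSubmodule) ψ⁻¹
      (_root_.contragredient ρ) := fun t f =>
    Subtype.ext (h.central.dual t f)
  refine ⟨hs, ?_, hc⟩
  let D' : LagrangianDatum ψ⁻¹ B := D.ofKer fun t => by rw [AddChar.inv_apply', inv_eq_one]
  have dual_apply : ∀ g (f : Module.Dual R V) u, ρ.dual g f u = f (ρ g⁻¹ u) := fun _ _ _ => rfl
  -- an invariant functional vanishes on the augmentation
  have hvanish : ∀ f : Module.Dual R V, (∀ l ∈ D.L, ρ.dual (D.lift l) f = f) →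
      D.augmentation ρ ≤ LinearMap.ker f := by
    intro f hf
    refine Submodule.span_le.mpr ?_
    rintro _ ⟨l, hl, u, rfl⟩
    have := LinearMap.congr_fun (hf l hl) (ρ (D.lift l) u)
    rw [dual_apply, Representation.inv_self_apply] at this
    change f (_ - _) = 0
    rw [map_sub, this, sub_self]
  obtain ⟨f₀, hf₀, hker⟩ := Submodule.exists_le_ker_of_notMem (K := R)
    (p := D.augmentation ρ) (v := v)
    fun hva => hv0 (fixed_inf_augmentation h.central hB h.smooth hv hva)
  -- the functional `f₀` is fixed by all elements of the group that act like lattice elements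
  have hfix : ∀ x : Heisenberg B, x.vec ∈ D.L → ψ (x.cen - D.q x.vec) = 1 →
      ρ.dual x f₀ = f₀ := by
    intro x hx hx'
    ext u
    have e := h.central.apply_eq x.vec x.cen (D.q x.vec) (ρ x⁻¹ u)
    rw [hx', one_smul] at e
    change ρ x (ρ x⁻¹ u) = _ at e
    rw [Representation.self_inv_apply] at e
    have hz : f₀ (ρ (D.lift x.vec) (ρ x⁻¹ u) - ρ x⁻¹ u) = 0 :=
      hker (sub_mem_augmentation hx _)
    rw [map_sub, sub_eq_zero] at hz
    rw [dual_apply, ← hz]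
    exact congrArg f₀ e.symm
  have hsm : f₀ ∈ (smoothVectors ρ.dual).toSubmodule := by
    refine isOpen_fixing_of_mem_nhds (Filter.mem_of_superset (IsOpen.mem_nhds
      (s := {x : Heisenberg B | x.vec ∈ D.L} ∩ {x | ψ (x.cen - D.q x.vec) = 1}) ?_ ?_)
      fun x hx => hfix x hx.1 hx.2)
    · exact (D.isOpen.preimage Heisenberg.continuous_vec).inter (IsOpen.preimage
        (Heisenberg.continuous_cen.sub (D.continuous_q.comp Heisenberg.continuous_vec)) hψ)
    · exact ⟨D.L.zero_mem, by simp [D.q_zero]⟩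
  refine isIrreducible_of_fixed_le (D := D') (v := ⟨f₀, hsm⟩) hc hB hs (fun l hl => ?_)
    (fun h0 => hf₀ ?_) fun f hf => ?_
  · exact Subtype.ext (hfix _ hl (by simp [LagrangianDatum.lift, D', LagrangianDatum.ofKer]))
  · rw [show f₀ = 0 from congrArg Subtype.val h0]
    rfl
  · have hf' := hvanish f.1 fun l hl => congrArg Subtype.val (hf l hl)
    refine Submodule.mem_span_singleton.mpr ⟨f.1 v / f₀ v, Subtype.ext (LinearMap.ext fun u => ?_)⟩
    have hu : u ∈ (cyclicSubrep ρ v).toSubmodule := by rw [hg]; trivial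
    obtain ⟨x, hx, z, hz, rfl⟩ := Submodule.mem_sup.mp (cyclicSubrep_le_sup h.central hB hv hu)
    obtain ⟨c, rfl⟩ := Submodule.mem_span_singleton.mp hx
    have h1 : f.1 z = 0 := hf' hz
    have h2 : f₀ z = 0 := hker hz
    change f.1 v / f₀ v * f₀ (c • v + z) = f.1 (c • v + z)
    rw [map_add, map_add, h1, h2, map_smul, map_smul, smul_eq_mul, smul_eq_mul]
    field_simp
    ring

end

/-! ### Orthogonal sums -/

section

variable {F R W₁ W₂ V₁ V₂ : Type*} [Field F] [Field R] [AddCommGroup W₁] [Module F W₁]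
  [AddCommGroup W₂] [Module F W₂]
  [AddCommGroup V₁] [Module R V₁] [AddCommGroup V₂] [Module R V₂]
  {ψ : AddChar F R} {B₁ : LinearMap.BilinForm F W₁} {B₂ : LinearMap.BilinForm F W₂}
  {ρ₁ : Representation R (Heisenberg B₁) V₁} {ρ₂ : Representation R (Heisenberg B₂) V₂}

theorem heisenbergTensor_apply_tmul (h₁ : HasCentralChar ψ ρ₁) (h₂ : HasCentralChar ψ ρ₂)
    (w₁ : W₁) (w₂ : W₂) (t₁ t₂ : F) (v₁ : V₁) (v₂ : V₂) :
    heisenbergTensor ψ ρ₁ ρ₂ h₁ h₂ ⟨(w₁, w₂), t₁ + t₂⟩ (v₁ ⊗ₜ v₂) =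
      ρ₁ ⟨w₁, t₁⟩ v₁ ⊗ₜ ρ₂ ⟨w₂, t₂⟩ v₂ := by
  rw [h₁.apply_eq w₁ t₁ 0, h₂.apply_eq w₂ t₂ 0, TensorProduct.smul_tmul_smul, sub_zero, sub_zero,
    ← AddChar.map_add_eq_mul]
  rfl

theorem isAlt_orthogonalSum (hB₁ : B₁.IsAlt) (hB₂ : B₂.IsAlt) : (orthogonalSum B₁ B₂).IsAlt := by
  intro x
  rw [orthogonalSum_apply, hB₁.self_eq_zero, hB₂.self_eq_zero, add_zero]

variable [TopologicalSpace F] [IsTopologicalRing F] [NeZero (2 : F)]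
  [TopologicalSpace W₁] [IsModuleTopology F W₁] [TopologicalSpace W₂] [IsModuleTopology F W₂]
  [FiniteDimensional F W₁] [FiniteDimensional F W₂]

open LagrangianDatum

theorem IsHeisenbergRep.heisenbergTensor (D₁ : LagrangianDatum ψ B₁) (D₂ : LagrangianDatum ψ B₂)
    (hB₁ : B₁.IsAlt) (hB₂ : B₂.IsAlt) (h₁ : IsHeisenbergRep ψ ρ₁)
    (h₂ : IsHeisenbergRep ψ ρ₂) :
    IsHeisenbergRep ψ (heisenbergTensor ψ ρ₁ ρ₂ h₁.central h₂.central) := by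
  obtain ⟨v₁, hv₁, hv0₁, hg₁⟩ := exists_generator h₁ hB₁ D₁
  obtain ⟨v₂, hv₂, hv0₂, hg₂⟩ := exists_generator h₂ hB₂ D₂
  set σ := _root_.heisenbergTensor ψ ρ₁ ρ₂ h₁.central h₂.central
  have hs : IsSmoothRep σ := isSmoothRep_of_span (TensorProduct.span_tmul_eq_top R V₁ V₂) <| by
    rintro _ ⟨u₁, u₂, rfl⟩
    have c₁ : Continuous fun x : Heisenberg (orthogonalSum B₁ B₂) =>
        (⟨x.vec.1, 0⟩ : Heisenberg B₁) :=
      Heisenberg.continuous_mk (continuous_fst.comp Heisenberg.continuous_vec) continuous_const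
    have c₂ : Continuous fun x : Heisenberg (orthogonalSum B₁ B₂) =>
        (⟨x.vec.2, x.cen⟩ : Heisenberg B₂) :=
      Heisenberg.continuous_mk (continuous_snd.comp Heisenberg.continuous_vec)
        Heisenberg.continuous_cen
    refine isOpen_fixing_of_mem_nhds (Filter.mem_of_superset (IsOpen.mem_nhds
      (((h₁.smooth u₁).preimage c₁).inter ((h₂.smooth u₂).preimage c₂)) ⟨?_, ?_⟩) ?_)
    · change ρ₁ 1 u₁ = u₁
      simp
    · change ρ₂ 1 u₂ = u₂
      simp
    · rintro ⟨⟨w₁, w₂⟩, t⟩ ⟨hx₁, hx₂⟩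
      have := heisenbergTensor_apply_tmul h₁.central h₂.central w₁ w₂ 0 t u₁ u₂
      rw [zero_add, show ρ₁ ⟨w₁, 0⟩ u₁ = u₁ from hx₁, show ρ₂ ⟨w₂, t⟩ u₂ = u₂ from hx₂] at this
      exact this
  have hc : HasCentralChar ψ σ := fun t x => by
    have e₁ : ρ₁ ⟨0, 0⟩ = 1 := map_one ρ₁
    have e₂ : ρ₂ ⟨0, 0⟩ = 1 := map_one ρ₂
    change (ψ t • TensorProduct.map (ρ₁ ⟨0, 0⟩) (ρ₂ ⟨0, 0⟩)) x = ψ t • x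
    rw [e₁, e₂, LinearMap.smul_apply, TensorProduct.map_one]
    rfl
  refine ⟨hs, isIrreducible_of_cyclicSubrep_eq_top (D := D₁.prod D₂) (v := v₁ ⊗ₜ v₂) hc
    (isAlt_orthogonalSum hB₁ hB₂) hs (fun l hl => ?_) (tmul_ne_zero_of_ne_zero hv0₁ hv0₂) ?_, hc⟩
  · refine (heisenbergTensor_apply_tmul h₁.central h₂.central l.1 l.2 _ _ v₁ v₂).trans ?_
    exact congrArg₂ (fun a b => a ⊗ₜ[R] b) (hv₁ l.1 hl.1) (hv₂ l.2 hl.2)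
  · refine eq_top_iff.mpr ?_
    change (⊤ : Submodule R (V₁ ⊗[R] V₂)) ≤ _
    rw [← TensorProduct.map₂_mk_top_top_eq_top,
      show (⊤ : Submodule R V₁) = (cyclicSubrep ρ₁ v₁).toSubmodule by rw [hg₁]; rfl,
      show (⊤ : Submodule R V₂) = (cyclicSubrep ρ₂ v₂).toSubmodule by rw [hg₂]; rfl]
    change Submodule.map₂ _ (Submodule.span R _) (Submodule.span R _) ≤ _
    rw [Submodule.map₂_span_span]
    refine Submodule.span_le.mpr ?_
    rintro _ ⟨_, ⟨g₁, rfl⟩, _, ⟨g₂, rfl⟩, rfl⟩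
    change ρ₁ g₁ v₁ ⊗ₜ ρ₂ g₂ v₂ ∈ cyclicSubrep σ (v₁ ⊗ₜ v₂)
    rw [← heisenbergTensor_apply_tmul h₁.central h₂.central]
    exact apply_mem_cyclicSubrep σ _ _

end

theorem proposition1p4
    {F : Type uF} [Field F] [TopologicalSpace F] [IsTopologicalRing F]
    (hF : IsFiniteOrNonarchimedeanLocal F) (hF2 : (2 : F) ≠ 0)
    {R : Type uR} [Field R]
    (ψ : AddChar F R) (hψ : IsSmoothAddChar ψ) (hψ1 : ψ ≠ 1) :
    -- Parts a), b), c), for one symplectic space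
    (∀ (W : Type uW) [AddCommGroup W] [Module F W] [FiniteDimensional F W]
        (B : LinearMap.BilinForm F W), B.IsAlt → B.Nondegenerate →
      (∀ (S : Type uS) [AddCommGroup S] [Module R S] (ρ : Representation R (Heisenberg B) S),
        IsHeisenbergRep ψ ρ →
          -- a) the contragredient is the Heisenberg representation of the inverse character
          (IsHeisenbergRep ψ⁻¹ (contragredient ρ) ∧
            ∀ (S' : Type uS') [AddCommGroup S'] [Module R S']
              (ρ' : Representation R (Heisenberg B) S'),
              IsHeisenbergRep ψ⁻¹ ρ' → Nonempty ((contragredient ρ).Equiv ρ')) ∧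
          -- b)
          IsAdmissibleRep ρ ∧ IsAbsolutelyIrreducible.{uE} ρ ∧ SatisfiesSchur ρ) ∧
      -- c)
      (∀ (V : Type uV) [AddCommGroup V] [Module R V] (π : Representation R (Heisenberg B) V),
        IsSmoothRep π → HasCentralChar ψ π → π.IsSemisimpleRepresentation)) ∧
    -- d) orthogonal sums
    (∀ (W₁ : Type uW₁) [AddCommGroup W₁] [Module F W₁] [FiniteDimensional F W₁]
        (W₂ : Type uW₂) [AddCommGroup W₂] [Module F W₂] [FiniteDimensional F W₂]
        (B₁ : LinearMap.BilinForm F W₁) (B₂ : LinearMap.BilinForm F W₂),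
        B₁.IsAlt → B₁.Nondegenerate → B₂.IsAlt → B₂.Nondegenerate →
      ∀ (S₁ : Type uS₁) [AddCommGroup S₁] [Module R S₁] (S₂ : Type uS₂) [AddCommGroup S₂]
        [Module R S₂] (ρ₁ : Representation R (Heisenberg B₁) S₁)
        (ρ₂ : Representation R (Heisenberg B₂) S₂)
        (h₁ : IsHeisenbergRep ψ ρ₁) (h₂ : IsHeisenbergRep ψ ρ₂),
        IsHeisenbergRep ψ (heisenbergTensor ψ ρ₁ ρ₂ h₁.central h₂.central) ∧
          ∀ (S : Type uS) [AddCommGroup S] [Module R S]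
            (ρ : Representation R (Heisenberg (orthogonalSum B₁ B₂)) S),
            IsHeisenbergRep ψ ρ →
              Nonempty ((heisenbergTensor ψ ρ₁ ρ₂ h₁.central h₂.central).Equiv ρ)) := by
  obtain ⟨I, J, hIJ⟩ := exists_isDualPair hF hψ hψ1
  have : NeZero (2 : F) := ⟨hF2⟩
  constructor
  · intro W _ _ _ B hB hB'
    let _ : TopologicalSpace W := moduleTopology F W
    have : IsModuleTopology F W := ⟨rfl⟩
    obtain ⟨D⟩ := exists_lagrangianDatum hIJ hF2 W B hB hB'
    let D' : LagrangianDatum ψ⁻¹ B := D.ofKer fun t => by rw [AddChar.inv_apply', inv_eq_one]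
    refine ⟨fun S _ _ ρ h => ?_, fun V _ _ π hs hc => D.isSemisimpleRepresentation hc hB hs⟩
    have hdual := h.contragredient hψ D hB
    exact ⟨⟨hdual, fun S' _ _ ρ' h' => hdual.nonempty_equiv D' hB h'⟩, h.isAdmissibleRep D hB,
      fun R' _ _ => h.repBaseChange D hB R', h.satisfiesSchur D hB⟩
  · intro W₁ _ _ _ W₂ _ _ _ B₁ B₂ hB₁ hB₁' hB₂ hB₂' S₁ _ _ S₂ _ _ ρ₁ ρ₂ h₁ h₂
    let _ : TopologicalSpace W₁ := moduleTopology F W₁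
    have : IsModuleTopology F W₁ := ⟨rfl⟩
    let _ : TopologicalSpace W₂ := moduleTopology F W₂
    have : IsModuleTopology F W₂ := ⟨rfl⟩
    obtain ⟨D₁⟩ := exists_lagrangianDatum hIJ hF2 W₁ B₁ hB₁ hB₁'
    obtain ⟨D₂⟩ := exists_lagrangianDatum hIJ hF2 W₂ B₂ hB₂ hB₂'
    have htensor := h₁.heisenbergTensor D₁ D₂ hB₁ hB₂ h₂
    exact ⟨htensor, fun S _ _ ρ h =>
      htensor.nonempty_equiv (D₁.prod D₂) (isAlt_orthogonalSum hB₁ hB₂) h⟩
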